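/- Let $k$ be an algebraically closed field. A *tensor category* is a rigid $k$-linear abelian monoidal category with $k$-bilinear tensor product, in which all morphism spaces are finite dimensional, all objects have finite length, and $\operatorname{End}(\mathbb 1)\cong k$. If $\mathcal C$ is a tensor category, $\mathbf D^b(\mathcal C)$ is monoidal through the total tensor product of bounded complexes (with differential $d\otimes 1+(-1)^i\,1\otimes d$ on the summand with first factor in degree $i$), and $\mathcal C\to\mathbf D^b(\mathcal C)$, $X\mapsto X$ in degree $0$, is a monoidal functor. For a monoidal category $\mathcal M$, a left $\mathcal M$-module category is a category with an action of $\mathcal M$ (with associativity and unit constraints satisfying the usual coherence axioms), and an $\mathcal M$-module functor is a functor $G$ with natural isomorphisms $X\otimes G(m)\cong G(X\otimes m)$ compatible with these constraints. Let $\mathcal C$, $\mathcal D$ be tensor categories over $k$, and let $\mathcal A\subset\mathcal C$, $\mathcal B\subset\mathcal D$ be (not necessarily full) abelian subcategories with finitely many simple objects up to isomorphism; that is, $\mathcal A$ and $\mathcal B$ are $k$-linear abelian categories with exact faithful $k$-linear inclusion functors $i_{\mathcal A}:\mathcal A\to\mathcal C$, $i_{\mathcal B}:\mathcal B\to\mathcal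 D$. Assume that $\mathbf D^b(\mathcal A)$ and $\mathbf D^b(\mathcal B)$ are left triangulated tensor ideals of $\mathbf D^b(\mathcal C)$ and $\mathbf D^b(\mathcal D)$: the induced triangulated functors $\mathbf D^b(i_{\mathcal A}):\mathbf D^b(\mathcal A)\to\mathbf D^b(\mathcal C)$ and $\mathbf D^b(i_{\mathcal B}):\mathbf D^b(\mathcal B)\to\mathbf D^b(\mathcal D)$ are faithful, and $\mathbf D^b(\mathcal A)$ (resp. $\mathbf D^b(\mathcal B)$) carries a left action of $\mathbf D^b(\mathcal C)$ (resp. $\mathbf D^b(\mathcal D)$) for which the inclusion is a module functor. Let $F:\mathbf D^b(\mathcal C)\to\mathbf D^b(\mathcal D)$ be a monoidal triangulated functor which restricts to $\mathbf D^b(\mathcal A)\to\mathbf D^b(\mathcal B)$; that is, there is a triangulated functor $G:\mathbf D^b(\mathcal A)\to\mathbf D^b(\mathcal B)$ with $\mathbf D^b(i_{\mathcal B})\circ G\cong F\circ\mathbf D^b(i_{\mathcal A})$, which is a $\mathbf D^b(\mathcal C)$-module functor when $\mathbf D^b(\mathcal C)$ acts on $\mathbf D^b(\mathcal B)$ through $F$.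 Suppose that $G$ is an equivalence. Then the action of $\mathcal C$ on $\mathbf D^b(\mathcal A)$ (through $\mathcal C\to\mathbf D^b(\mathcal C)$) and its action on $\mathbf D^b(\mathcal B)$ (through $\mathcal C\to\mathbf D^b(\mathcal C)\xrightarrow{F}\mathbf D^b(\mathcal D)$) restrict to actions of $\mathcal C$ on $\mathcal A$ and on $\mathcal B$: there are left $\mathcal C$-module category structures on $\mathcal A$ and $\mathcal B$, biadditive and exact in each variable, for which the degree-zero embeddings $\mathcal A\to\mathbf D^b(\mathcal A)$ and $\mathcal B\to\mathbf D^b(\mathcal B)$ are $\mathcal C$-module functors; and with these structures there is an equivalence $\mathcal A\simeq\mathcal B$ of left $\mathcal C$-module categories. The action on $\mathcal A$ is $k$-bilinear on morphisms, and if $F$ is $k$-linear, then so is the action on $\mathcal B$, and the equivalence is $k$-linear. -/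

import Mathlib

open CategoryTheory CategoryTheory.Limits CategoryTheory.MonoidalCategory

namespace BoundedTensor

universe v u v' u'

section FiniteSupport

variable {C : Type u} [Category.{v} C] [Preadditive C]
  {D : Type u'} [Category.{v'} D] [Preadditive D] {J : Type}

/-- A cofan with finitely many biproduct-like projections is a colimit. -/
def isColimitOfProj {X : J → C} (c : Cofan X) (s : Finset J) (p : ∀ j, c.pt ⟶ X j)
    (h1 : ∀ j, c.inj j ≫ p j = 𝟙 (X j)) (h2 : ∀ i j, i ≠ j → c.inj i ≫ p j = 0)
    (h3 : ∑ j ∈ s, p j ≫ c.inj j = 𝟙 c.pt) : IsColimit c :=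
  Limits.Cofan.IsColimit.mk c (fun t => ∑ j ∈ s, p j ≫ t.inj j)
    (fun t i => by
      classical
      have h0 : i ∉ s → 𝟙 (X i) = 0 := fun hi => by
        rw [← h1 i, ← Category.comp_id (c.inj i), ← h3, Preadditive.comp_sum,
          Finset.sum_eq_zero, zero_comp]
        intro j hj
        rw [← Category.assoc, h2 i j (fun h => hi (h ▸ hj)), zero_comp]
      rw [Preadditive.comp_sum, Finset.sum_eq_single i]
      · rw [← Category.assoc, h1, Category.id_comp]
      · intro j _ hj
        rw [← Category.assoc, h2 i j hj.symm, zero_comp]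
      · intro hi
        rw [← Category.id_comp (t.inj i), h0 hi, zero_comp, ← Category.assoc, h1, h0 hi, zero_comp])
    (fun t m hm => by
      rw [← Category.id_comp m, ← h3, Preadditive.sum_comp]
      exact Finset.sum_congr rfl (fun j _ => by rw [Category.assoc, hm]))

open Classical in
/-- The projections of a coproduct in a preadditive category. -/
noncomputable def cofanProj {X : J → C} {c : Cofan X} (hc : IsColimit c) (j : J) : c.pt ⟶ X j :=
  Limits.Cofan.IsColimit.desc hc (fun i => if h : i = j then eqToHom (by rw [h]) else 0)

lemma inj_cofanProj_self {X : J → C} {c : Cofan X} (hc : IsColimit c) (j : J) :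
    c.inj j ≫ cofanProj hc j = 𝟙 (X j) := by
  simp [cofanProj]

lemma inj_cofanProj_ne {X : J → C} {c : Cofan X} (hc : IsColimit c) (i j : J) (h : i ≠ j) :
    c.inj i ≫ cofanProj hc j = 0 := by
  simp [cofanProj, h]

lemma sum_cofanProj {X : J → C} {c : Cofan X} (hc : IsColimit c) (s : Finset J)
    (hs : ∀ j, j ∉ s → IsZero (X j)) : ∑ j ∈ s, cofanProj hc j ≫ c.inj j = 𝟙 c.pt := by
  classical
  refine Limits.Cofan.IsColimit.hom_ext hc _ _ (fun i => ?_)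
  rw [Preadditive.comp_sum, Category.comp_id]
  by_cases hi : i ∈ s
  · rw [Finset.sum_eq_single i]
    · rw [← Category.assoc, inj_cofanProj_self, Category.id_comp]
    · intro j _ hj
      rw [← Category.assoc, inj_cofanProj_ne hc i j hj.symm, zero_comp]
    · exact fun h => (h hi).elim
  · exact (hs i hi).eq_of_src _ _

lemma hasCoproduct_of_finite [HasFiniteBiproducts C] (X : J → C)
    (hX : {j | ¬ IsZero (X j)}.Finite) : HasCoproduct X := by
  classical
  obtain ⟨s, hs⟩ : ∃ s : Finset J, ∀ j, j ∉ s → IsZero (X j) :=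
    ⟨hX.toFinset, fun j hj => by simpa using hj⟩
  let Y : s → C := fun j => X j
  let c : Cofan X := Cofan.mk (⨁ Y) (fun j => if h : j ∈ s then biproduct.ι Y ⟨j, h⟩ else 0)
  refine ⟨⟨c, isColimitOfProj c s (fun j => if h : j ∈ s then biproduct.π Y ⟨j, h⟩ else 0)
    ?_ ?_ ?_⟩⟩
  · intro j
    by_cases h : j ∈ s
    · simp [c, h, Y]
    · exact (hs j h).eq_of_src _ _
  · intro i j hij
    by_cases h : i ∈ s
    · by_cases h' : j ∈ s
      · simp only [c, cofan_mk_inj, h, h', dif_pos]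
        exact biproduct.ι_π_ne Y (fun h => hij (congrArg Subtype.val h))
      · exact (hs j h').eq_of_tgt _ _
    · exact (hs i h).eq_of_src _ _
  · rw [← Finset.sum_attach]
    have := biproduct.total (f := Y)
    rw [← Finset.univ_eq_attach]
    refine Eq.trans (Finset.sum_congr rfl (fun j _ => ?_)) this
    simp [c]

lemma preservesColimit_of_finite (F : C ⥤ D) [F.Additive] (X : J → C)
    (hX : {j | ¬ IsZero (X j)}.Finite) : PreservesColimit (Discrete.functor X) F where
  preserves {c} hc := by
    obtain ⟨s, hs⟩ : ∃ s : Finset J, ∀ j, j ∉ s → IsZero (X j) :=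
      ⟨hX.toFinset, fun j hj => by simpa using hj⟩
    let c' : Cofan (fun j => F.obj (X j)) := Cofan.mk (F.obj c.pt) (fun j => F.map (Cofan.inj c j))
    have : IsColimit c' := isColimitOfProj c' s (fun j => F.map (cofanProj hc j))
      (fun j => by
        change F.map _ ≫ F.map _ = _
        rw [← F.map_comp, inj_cofanProj_self, F.map_id])
      (fun i j h => by
        change F.map _ ≫ F.map _ = _
        rw [← F.map_comp, inj_cofanProj_ne hc i j h, F.map_zero])
      (by
        change ∑ j ∈ s, F.map _ ≫ F.map _ = 𝟙 (F.obj c.pt)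
        simp only [← F.map_comp]
        rw [← F.map_sum, sum_cofanProj hc s hs, F.map_id])
    refine ⟨IsColimit.ofIsoColimit
      ((IsColimit.precomposeHomEquiv (Discrete.natIso (fun j => Iso.refl _) :
        Discrete.functor X ⋙ F ≅ Discrete.functor (fun j => F.obj (X j))) _).symm this) ?_⟩
    refine Cocone.ext (Iso.refl _) (fun j => ?_)
    dsimp
    erw [Category.comp_id, Category.id_comp]
    rfl

end FiniteSupport


section Graded

variable {C : Type u} [Category.{v} C] [Abelian C] [MonoidalCategory C]
  [MonoidalPreadditive C]

lemma isZero_tensor_left {X : C} (hX : IsZero X) (Y : C) : IsZero (X ⊗ Y) :=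
  (tensorRight Y).map_isZero hX

lemma isZero_tensor_right (X : C) {Y : C} (hY : IsZero Y) : IsZero (X ⊗ Y) :=
  (tensorLeft X).map_isZero hY

/-- Bounded graded objects. -/
class GrBounded (X : GradedObject ℤ C) : Prop where
  out : ∃ a b : ℤ, ∀ i, i ∉ Set.Icc a b → IsZero (X i)

open GradedObject

lemma finite_tensor₂ (X Y : GradedObject ℤ C) [hX : GrBounded X] [hY : GrBounded Y]
    (S : Set (ℤ × ℤ)) : {j : S | ¬ IsZero (X j.1.1 ⊗ Y j.1.2)}.Finite := by
  obtain ⟨a, b, hab⟩ := hX.out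
  obtain ⟨a', b', hab'⟩ := hY.out
  refine Set.Finite.subset (Set.Finite.preimage (f := (Subtype.val : S → ℤ × ℤ))
    Subtype.val_injective.injOn ((Set.finite_Icc a b).prod (Set.finite_Icc a' b'))) ?_
  rintro ⟨⟨i, j⟩, h⟩ hij
  constructor
  · by_contra h
    exact hij (isZero_tensor_left (hab _ h) _)
  · by_contra h
    exact hij (isZero_tensor_right _ (hab' _ h))

lemma finite_tensor₃ (X Y Z : GradedObject ℤ C) [hX : GrBounded X] [hY : GrBounded Y]
    [hZ : GrBounded Z] (S : Set (ℤ × ℤ × ℤ)) :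
    {j : S | ¬ IsZero (X j.1.1 ⊗ Y j.1.2.1 ⊗ Z j.1.2.2)}.Finite := by
  obtain ⟨a, b, hab⟩ := hX.out
  obtain ⟨a', b', hab'⟩ := hY.out
  obtain ⟨a'', b'', hab''⟩ := hZ.out
  refine Set.Finite.subset (Set.Finite.preimage (f := (Subtype.val : S → ℤ × ℤ × ℤ))
    Subtype.val_injective.injOn ((Set.finite_Icc a b).prod
      ((Set.finite_Icc a' b').prod (Set.finite_Icc a'' b'')))) ?_
  rintro ⟨⟨i, j, k⟩, h⟩ hij
  refine ⟨?_, ?_, ?_⟩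
  · by_contra h
    exact hij (isZero_tensor_left (hab _ h) _)
  · by_contra h
    exact hij (isZero_tensor_right _ (isZero_tensor_left (hab' _ h) _))
  · by_contra h
    exact hij (isZero_tensor_right _ (isZero_tensor_right _ (hab'' _ h)))

instance grHasTensor (X Y : GradedObject ℤ C) [GrBounded X] [GrBounded Y] : HasTensor X Y :=
  fun _ =>
    have : HasFiniteBiproducts C := Abelian.hasFiniteBiproducts
    hasCoproduct_of_finite _ (finite_tensor₂ X Y _)

instance grGood₁₂ (X Y Z : GradedObject ℤ C) [GrBounded X] [GrBounded Y] :
    HasGoodTensor₁₂Tensor X Y Z := fun _ i₃ => by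
  have : ((curriedTensor C).flip.obj (Z i₃)).Additive := inferInstanceAs (tensorRight (Z i₃)).Additive
  exact preservesColimit_of_finite _ _ (finite_tensor₂ X Y _)

instance grGood₂₃ (X Y Z : GradedObject ℤ C) [GrBounded Y] [GrBounded Z] :
    HasGoodTensorTensor₂₃ X Y Z := fun i₁ _ => by
  have : ((curriedTensor C).obj (X i₁)).Additive := inferInstanceAs (tensorLeft (X i₁)).Additive
  exact preservesColimit_of_finite _ _ (finite_tensor₂ Y Z _)

instance grExt (X Y Z T : GradedObject ℤ C) [GrBounded Y] [GrBounded Z] [GrBounded T] :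
    HasTensor₄ObjExt X Y Z T := fun i₁ _ => by
  have : ((curriedTensor C).obj (X i₁)).Additive := inferInstanceAs (tensorLeft (X i₁)).Additive
  exact preservesColimit_of_finite _ _ (finite_tensor₃ Y Z T _)

instance grEmpty₁ (X : C) : PreservesColimit (Functor.empty.{0} C) ((curriedTensor C).obj X) := by
  have : ((curriedTensor C).obj X).Additive := inferInstanceAs (tensorLeft X).Additive
  have := Functor.preservesInitialObject_of_preservesZeroMorphisms ((curriedTensor C).obj X)
  infer_instance

instance grEmpty₂ (X : C) :
    PreservesColimit (Functor.empty.{0} C) ((curriedTensor C).flip.obj X) := by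
  have : ((curriedTensor C).flip.obj X).Additive := inferInstanceAs (tensorRight X).Additive
  have := Functor.preservesInitialObject_of_preservesZeroMorphisms ((curriedTensor C).flip.obj X)
  infer_instance

instance grBounded_tensor (X Y : GradedObject ℤ C) [hX : GrBounded X] [hY : GrBounded Y] :
    GrBounded (Monoidal.tensorObj X Y) where
  out := by
    obtain ⟨a, b, hab⟩ := hX.out
    obtain ⟨a', b', hab'⟩ := hY.out
    refine ⟨a + a', b + b', fun n hn => ?_⟩
    rw [IsZero.iff_id_eq_zero]
    refine Monoidal.tensorObj_ext _ _ (fun i j hij => IsZero.eq_of_src ?_ _ _)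
    by_cases hi : i ∈ Set.Icc a b
    · refine isZero_tensor_right _ (hab' _ (fun hj => hn ?_))
      simp only [Set.mem_Icc] at *
      omega
    · exact isZero_tensor_left (hab _ hi) _

instance grBounded_unit : GrBounded (Monoidal.tensorUnit : GradedObject ℤ C) where
  out := ⟨0, 0, fun i hi => by
    have := Monoidal.isInitialTensorUnitApply (C := C) i (by
      simp only [Set.mem_Icc] at hi; omega)
    exact (IsZero.iff_id_eq_zero _).2 (this.hom_ext _ _)⟩

variable (C) in
/-- The category of bounded graded objects. -/
abbrev GrB := ObjectProperty.FullSubcategory (fun X : GradedObject ℤ C => GrBounded X)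

instance (X : GrB C) : GrBounded X.obj := X.property

noncomputable instance grBMonoidal : MonoidalCategory (GrB C) where
  tensorObj X Y := ⟨Monoidal.tensorObj X.obj Y.obj, inferInstance⟩
  tensorHom f g := ObjectProperty.homMk (Monoidal.tensorHom f.hom g.hom)
  whiskerLeft X _ _ φ := ObjectProperty.homMk (Monoidal.whiskerLeft X.obj φ.hom)
  whiskerRight φ Y := ObjectProperty.homMk (Monoidal.whiskerRight φ.hom Y.obj)
  tensorUnit := ⟨Monoidal.tensorUnit, inferInstance⟩
  associator X₁ X₂ X₃ := ObjectProperty.isoMk _ (Monoidal.associator X₁.obj X₂.obj X₃.obj)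
  leftUnitor X := ObjectProperty.isoMk _ (Monoidal.leftUnitor X.obj)
  rightUnitor X := ObjectProperty.isoMk _ (Monoidal.rightUnitor X.obj)
  tensorHom_def f g := ObjectProperty.hom_ext _ (Monoidal.tensorHom_def f.hom g.hom)
  id_tensorHom_id X Y := ObjectProperty.hom_ext _ (Monoidal.id_tensorHom_id X.obj Y.obj)
  whiskerLeft_id X Y := ObjectProperty.hom_ext _ (Monoidal.id_tensorHom_id X.obj Y.obj)
  id_whiskerRight X Y := ObjectProperty.hom_ext _ (Monoidal.id_tensorHom_id X.obj Y.obj)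
  tensorHom_comp_tensorHom f₁ f₂ g₁ g₂ := ObjectProperty.hom_ext _
    (Monoidal.tensorHom_comp_tensorHom f₁.hom g₁.hom f₂.hom g₂.hom)
  associator_naturality f₁ f₂ f₃ := ObjectProperty.hom_ext _
    (Monoidal.associator_naturality f₁.hom f₂.hom f₃.hom)
  leftUnitor_naturality f := ObjectProperty.hom_ext _ (Monoidal.leftUnitor_naturality f.hom)
  rightUnitor_naturality f := ObjectProperty.hom_ext _ (Monoidal.rightUnitor_naturality f.hom)
  pentagon X₁ X₂ X₃ X₄ := ObjectProperty.hom_ext _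
    (Monoidal.pentagon X₁.obj X₂.obj X₃.obj X₄.obj)
  triangle X₁ X₂ := ObjectProperty.hom_ext _ (Monoidal.triangle X₁.obj X₂.obj)

end Graded

section Complexes

variable (C : Type u) [Category.{v} C] [Abelian C]

/-- The property of being a bounded cochain complex. -/
def bddProp : ObjectProperty (CochainComplex C ℤ) := fun K => GrBounded K.X

/-- The category of bounded cochain complexes. -/
abbrev ChB := (bddProp C).FullSubcategory

/-- The inclusion of bounded complexes in all complexes. -/
abbrev ChB.ι : ChB C ⥤ CochainComplex C ℤ := (bddProp C).ι

variable {C}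

instance (K : ChB C) : GrBounded K.obj.X := K.property

variable [MonoidalCategory C] [MonoidalPreadditive C]

instance bdd_tensor (K L : ChB C) :
    GrBounded (HomologicalComplex.tensorObj K.obj L.obj).X :=
  inferInstanceAs (GrBounded (GradedObject.Monoidal.tensorObj K.obj.X L.obj.X))

instance bdd_unit : GrBounded (HomologicalComplex.tensorUnit C (ComplexShape.up ℤ)).X where
  out := ⟨0, 0, fun i hi => HomologicalComplex.isZero_single_obj_X _ _ _ _ (by
    simp only [Set.mem_Icc] at hi; omega)⟩

noncomputable instance chBStruct : MonoidalCategoryStruct (ChB C) where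
  tensorObj K L := ⟨HomologicalComplex.tensorObj K.obj L.obj, bdd_tensor K L⟩
  whiskerLeft K _ _ g := ObjectProperty.homMk (HomologicalComplex.tensorHom (𝟙 K.obj) g.hom)
  whiskerRight f L := ObjectProperty.homMk (HomologicalComplex.tensorHom f.hom (𝟙 L.obj))
  tensorHom f g := ObjectProperty.homMk (HomologicalComplex.tensorHom f.hom g.hom)
  tensorUnit := ⟨HomologicalComplex.tensorUnit C (ComplexShape.up ℤ), bdd_unit⟩
  associator K L M := ObjectProperty.isoMk _ (HomologicalComplex.associator K.obj L.obj M.obj)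
  leftUnitor K := ObjectProperty.isoMk _ (HomologicalComplex.leftUnitor K.obj)
  rightUnitor K := ObjectProperty.isoMk _ (HomologicalComplex.rightUnitor K.obj)

variable (C) in
/-- The underlying bounded graded object. -/
def chBForget : ChB C ⥤ GrB C where
  obj K := ⟨K.obj.X, K.property⟩
  map f := ObjectProperty.homMk f.hom.f

instance : (chBForget C).Faithful where
  map_injective {X Y f g} h := ObjectProperty.hom_ext _ (by
    ext i
    exact congrFun (congrArg (fun t => t.hom) h) i)

lemma assoc_aux {E : Type*} [Category* E] [MonoidalCategory E] (X Y Z : E)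
    (a : (X ⊗ Y) ⊗ Z ⟶ X ⊗ Y ⊗ Z) :
    (𝟙 _ ≫ (𝟙 (X ⊗ Y) ⊗ₘ 𝟙 Z)) ≫ a ≫ ((𝟙 X ⊗ₘ 𝟙 (Y ⊗ Z)) ≫ 𝟙 _) = a := by
  simp

/-- The data transporting the monoidal structure from bounded graded objects. -/
noncomputable def chBInducing : Monoidal.InducingFunctorData (chBForget C) where
  μIso _ _ := Iso.refl _
  εIso := ObjectProperty.isoMk _ (HomologicalComplex.tensorUnitIso C (ComplexShape.up ℤ))
  whiskerLeft_eq K L₁ L₂ g := by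
    erw [Category.id_comp, Category.comp_id]
    rfl
  whiskerRight_eq f L := by
    erw [Category.id_comp, Category.comp_id]
    rfl
  tensorHom_eq f g := by
    erw [Category.id_comp, Category.comp_id]
    rfl
  associator_eq K L M := (assoc_aux ((chBForget C).obj K) ((chBForget C).obj L)
    ((chBForget C).obj M) (α_ _ _ _).hom).symm
  leftUnitor_eq K := by
    dsimp
    erw [Category.id_comp]
    rfl
  rightUnitor_eq K := by
    dsimp
    erw [Category.id_comp]
    rfl

noncomputable instance chBMonoidal : MonoidalCategory (ChB C) :=
  Monoidal.induced _ chBInducing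

end Complexes

section Localization

open ZeroObject Pretriangulated HomotopicalAlgebra HomologicalComplex

variable {C : Type u} [Category.{v} C] [Abelian C]

lemma bddProp_iff (K : CochainComplex C ℤ) :
    bddProp C K ↔ ∃ a b : ℤ, K.IsStrictlyGE a ∧ K.IsStrictlyLE b := by
  constructor
  · rintro ⟨a, b, h⟩
    refine ⟨a, b, ?_, ?_⟩
    · rw [CochainComplex.isStrictlyGE_iff]
      exact fun i hi => h i (fun h' => by simp only [Set.mem_Icc] at h'; omega)
    · rw [CochainComplex.isStrictlyLE_iff]
      exact fun i hi => h i (fun h' => by simp only [Set.mem_Icc] at h'; omega)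
  · rintro ⟨a, b, _, _⟩
    refine ⟨a, b, fun i hi => ?_⟩
    by_cases h : i < a
    · exact K.isZero_of_isStrictlyGE a i h
    · exact K.isZero_of_isStrictlyLE b i (by simp only [Set.mem_Icc] at hi; omega)

lemma bddProp_shift (K : CochainComplex C ℤ) (hK : bddProp C K) (n : ℤ) :
    bddProp C (K⟦n⟧) := by
  rw [bddProp_iff] at hK ⊢
  obtain ⟨a, b, _, _⟩ := hK
  exact ⟨a - n, b - n, K.isStrictlyGE_shift a n (a - n) (by lia),
    K.isStrictlyLE_shift b n (b - n) (by lia)⟩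

lemma bddProp_mappingCone {K L : CochainComplex C ℤ} (f : K ⟶ L) (hK : bddProp C K)
    (hL : bddProp C L) : bddProp C (CochainComplex.mappingCone f) := by
  obtain ⟨a, b, h⟩ := hK
  obtain ⟨a', b', h'⟩ := hL
  refine ⟨min (a - 1) a', max b b', fun i hi => ?_⟩
  rw [CochainComplex.mappingCone.isZero_X_iff]
  simp only [Set.mem_Icc] at hi h h'
  exact ⟨h _ (by omega), h' _ (by omega)⟩

lemma bddProp_cylinder (K : CochainComplex C ℤ) (hK : bddProp C K) :
    bddProp C (cylinder K) := by
  obtain ⟨a, b, h⟩ := hK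
  refine ⟨a - 1, b, fun i hi => ?_⟩
  simp only [Set.mem_Icc] at hi h
  dsimp [cylinder]
  refine homotopyCofiber.isZero_X _ _ ?_ (fun j hj ↦ ?_)
  · refine IsZero.of_iso ?_ ((HomologicalComplex.eval C (.up ℤ) i).mapBiprod _ _)
    exact (biprod_isZero_iff _ _).2 ⟨h _ (by omega), h _ (by omega)⟩
  · simp only [ComplexShape.up_Rel] at hj
    exact h _ (by omega)

variable (C) in
/-- Bounded complexes in the homotopy category of bounded below complexes. -/
def bddPlus : ObjectProperty (HomotopyCategory.Plus C) := fun K =>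
  ∃ (L : CochainComplex C ℤ), bddProp C L ∧
    Nonempty ((HomotopyCategory.Plus.ι C).obj K ≅ (HomotopyCategory.quotient C (.up ℤ)).obj L)

variable (C) in
/-- The homotopy category of bounded complexes. -/
abbrev KB := (bddPlus C).FullSubcategory

lemma bddProp_plus (K : CochainComplex C ℤ) (hK : bddProp C K) : CochainComplex.plus C K := by
  obtain ⟨a, b, ha, hb⟩ := (bddProp_iff _).1 hK
  exact ⟨a, ha⟩

variable (C) in
/-- Bounded complexes are bounded below. -/
abbrev chBToPlus : ChB C ⥤ CochainComplex.Plus C := ObjectProperty.ιOfLE (bddProp_plus (C := C))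

lemma bddPlus_quotient (K : CochainComplex.Plus C) (hK : bddProp C K.obj) :
    bddPlus C ((HomotopyCategory.Plus.quotient C).obj K) := ⟨K.obj, hK, ⟨Iso.refl _⟩⟩

instance : (bddPlus C).ContainsZero where
  exists_zero := by
    let Z : CochainComplex C ℤ := (single C (.up ℤ) 0).obj 0
    have hZ : Z.IsStrictlyGE 0 := inferInstance
    have hZ' : Z.IsStrictlyLE 0 := inferInstance
    refine ⟨(HomotopyCategory.Plus.quotient C).obj ⟨Z, 0, hZ⟩, ?_,
      bddPlus_quotient _ ((bddProp_iff _).2 ⟨0, 0, hZ, hZ'⟩)⟩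
    have h0 : IsZero ((HomotopyCategory.quotient C (.up ℤ)).obj Z) :=
      Functor.map_isZero _ (Functor.map_isZero _ (isZero_zero C))
    rw [IsZero.iff_id_eq_zero] at h0 ⊢
    exact (HomotopyCategory.Plus.ι C).map_injective h0

instance : (bddPlus C).IsClosedUnderIsomorphisms where
  of_iso e := by
    rintro ⟨L, hL, ⟨e'⟩⟩
    exact ⟨L, hL, ⟨(HomotopyCategory.Plus.ι C).mapIso e.symm ≪≫ e'⟩⟩

instance : (bddPlus C).IsStableUnderShift ℤ where
  isStableUnderShiftBy n :=
    { le_shift K := by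
        rintro ⟨L, hL, ⟨e⟩⟩
        exact ⟨L⟦n⟧, bddProp_shift L hL n,
          ⟨((HomotopyCategory.Plus.ι C).commShiftIso n).app K ≪≫
            (shiftFunctor _ n).mapIso e ≪≫
            (((HomotopyCategory.quotient C (.up ℤ)).commShiftIso n).app L).symm⟩⟩ }

instance : (bddPlus C).IsTriangulatedClosed₃ := .mk' (by
    rintro T hT ⟨L₁, h₁, ⟨e₁⟩⟩ ⟨L₂, h₂, ⟨e₂⟩⟩
    obtain ⟨f, hf⟩ := (HomotopyCategory.quotient C (.up ℤ)).map_surjective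
      (e₁.inv ≫ T.mor₁.hom ≫ e₂.hom)
    refine ⟨_, bddProp_mappingCone f h₁ h₂, ⟨?_⟩⟩
    refine Triangle.π₃.mapIso (isoTriangleOfIso₁₂ ((HomotopyCategory.Plus.ι C).mapTriangle.obj T) _
      ((HomotopyCategory.Plus.ι C).map_distinguished _ hT)
      (HomotopyCategory.mappingCone_triangleh_distinguished f) e₁ e₂ ?_)
    change T.mor₁.hom ≫ _ = _ ≫ (HomotopyCategory.quotient C (.up ℤ)).map f
    rw [hf, Iso.hom_inv_id_assoc])

instance : (bddPlus C).IsTriangulated where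
  toIsTriangulatedClosed₂ := .of_isTriangulatedClosed₃

instance : (bddPlus C).IsVerdierLeftLocalizing
    (HomotopyCategory.Plus.subcategoryAcyclic C) where
  fac {K L} φ hK hL := by
    obtain ⟨K', hK', ⟨e⟩⟩ := hK
    obtain ⟨f, hf⟩ := (HomotopyCategory.quotient C (.up ℤ)).map_surjective
      (Y := L.obj.as) (e.inv ≫ φ.hom)
    have hL' : L.obj.as.Acyclic :=
      (HomotopyCategory.quotient_obj_mem_subcategoryAcyclic_iff_acyclic L.obj.as).1 hL
    obtain ⟨a, b, ha, hb⟩ := (bddProp_iff _).1 hK'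
    obtain ⟨c, hc⟩ := (HomotopyCategory.plus_quotient_obj_iff L.obj.as).1 L.property
    let M := CochainComplex.truncLE L.obj.as b
    have hM : M.IsStrictlyGE c := inferInstance
    have hM' : M.IsStrictlyLE b := inferInstance
    have hMa : M.Acyclic := hL'.truncLE _
    let Z : HomotopyCategory.Plus C := (HomotopyCategory.Plus.quotient C).obj ⟨M, c, hM⟩
    refine ⟨Z,
      ObjectProperty.homMk (e.hom ≫ (HomotopyCategory.quotient C (.up ℤ)).map
        (inv (CochainComplex.ιTruncLE K' b) ≫ CochainComplex.truncLEMap f b)),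
      ObjectProperty.homMk ((HomotopyCategory.quotient C (.up ℤ)).map
        (CochainComplex.ιTruncLE L.obj.as b)),
      bddPlus_quotient _ ((bddProp_iff _).2 ⟨c, b, hM, hM'⟩),
      (HomotopyCategory.quotient_obj_mem_subcategoryAcyclic_iff_acyclic M).2 hMa, ?_⟩
    apply ObjectProperty.hom_ext
    change (e.hom ≫ (HomotopyCategory.quotient C (.up ℤ)).map _) ≫
      (HomotopyCategory.quotient C (.up ℤ)).map _ = φ.hom
    rw [Category.assoc, ← Functor.map_comp, Category.assoc, CochainComplex.ιTruncLE_naturality,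
      IsIso.inv_hom_id_assoc, hf]
    exact e.hom_inv_id_assoc φ.hom

variable (C) in
/-- The functor from bounded complexes to their homotopy category. -/
def quotientB : ChB C ⥤ KB C :=
  (bddPlus C).lift (chBToPlus C ⋙ HomotopyCategory.Plus.quotient C)
    (fun K => bddPlus_quotient _ K.property)

instance : (quotientB C).EssSurj where
  mem_essImage K := by
    obtain ⟨L, hL, ⟨e⟩⟩ := K.property
    exact ⟨⟨L, hL⟩, ⟨(bddPlus C).isoMk ((HomotopyCategory.Plus.ι C).preimageIso e.symm)⟩⟩

instance : (quotientB C).Full := by dsimp [quotientB]; infer_instance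

/-- The pre-cylinder object attached to a bounded complex. -/
noncomputable abbrev chBPrecylinder (K : ChB C) : Precylinder K :=
  K.obj.precylinder.toFullSubcategory (bddProp_cylinder K.obj K.property)

instance : (quotientB C).IsLocalization
      ((homotopyEquivalences C (.up ℤ)).inverseImage (ChB.ι C)) :=
  Functor.isLocalization_of_essSurj_of_full_of_exists_cylinders _ _
    (fun K L f hf ↦ by
      rw [← isIso_iff_of_reflects_iso _ ((bddPlus C).ι ⋙ HomotopyCategory.Plus.ι C)]
      rw [← HomotopyCategory.inverseImage_quotient_isomorphisms] at hf
      exact hf) (by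
    rintro K L f₀ f₁ hf
    obtain ⟨f₀, rfl⟩ := ObjectProperty.homMk_surjective f₀
    obtain ⟨f₁, rfl⟩ := ObjectProperty.homMk_surjective f₁
    replace hf := HomotopyCategory.homotopyOfEq f₀ f₁
      (((bddPlus C).ι ⋙ HomotopyCategory.Plus.ι C).congr_map hf)
    exact ⟨chBPrecylinder K, Precylinder.LeftHomotopy.fullSubcategoryEquiv.symm
      { h := cylinder.desc _ _ hf
        h₀ := cylinder.ι₀_desc _ _ hf
        h₁ := cylinder.ι₁_desc _ _ hf }, ⟨cylinder.homotopyEquiv _ (fun n ↦ ⟨n - 1, by simp⟩), rfl⟩⟩)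

section

variable [HasDerivedCategory.{v'} C]

open DerivedCategory DerivedCategory.TStructure

lemma bounded_Q_obj (K : CochainComplex C ℤ) (hK : bddProp C K) : t.bounded (Q.obj K) := by
  obtain ⟨a, b, _, _⟩ := (bddProp_iff _).1 hK
  exact ⟨⟨a, inferInstance⟩, ⟨b, inferInstance⟩⟩

variable (C) in
/-- The functor from the homotopy category of bounded complexes to the bounded derived
category. -/
noncomputable def QhB : KB C ⥤ Bounded C :=
  t.bounded.lift ((bddPlus C).ι ⋙ HomotopyCategory.Plus.ι C ⋙ DerivedCategory.Qh) (by
    rintro ⟨K, L, hL, ⟨e⟩⟩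
    exact t.bounded.prop_of_iso ((quotientCompQhIso C).symm.app L ≪≫ DerivedCategory.Qh.mapIso e.symm)
      (bounded_Q_obj _ hL))

variable (C) in
/-- The inclusion of the bounded derived category in the bounded below derived category. -/
noncomputable abbrev boundedToPlus : Bounded C ⥤ DerivedCategory.Plus C :=
  ObjectProperty.ιOfLE (P := (t : Triangulated.TStructure (DerivedCategory C)).bounded)
    (P' := t.plus) (fun _ h => h.1)

lemma exists_bounded_iso (X : Bounded C) :
    ∃ (K : CochainComplex C ℤ) (_ : bddProp C K), Nonempty (X.obj ≅ Q.obj K) := by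
  obtain ⟨⟨a, _⟩, ⟨b, _⟩⟩ := X.property
  obtain ⟨K, h1, h2, e⟩ := exists_iso_Q_obj_of_isGE_of_isLE X.obj a b
  exact ⟨K, (bddProp_iff _).2 ⟨a, b, h1, h2⟩, e⟩

instance : (QhB C).EssSurj where
  mem_essImage X := by
    obtain ⟨K, hK, ⟨e⟩⟩ := exists_bounded_iso X
    obtain ⟨a, b, ha, hb⟩ := (bddProp_iff _).1 hK
    exact ⟨⟨(HomotopyCategory.Plus.quotient C).obj ⟨K, a, ha⟩, bddPlus_quotient _ hK⟩,
      ⟨t.bounded.isoMk ((quotientCompQhIso C).app K ≪≫ e.symm)⟩⟩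

instance : (QhB C).IsLocalization ((HomotopyCategory.Plus.subcategoryAcyclic C).inverseImage
    (bddPlus C).ι).trW :=
  ((bddPlus C).triangulatedLocalizerMorphism
    (HomotopyCategory.Plus.subcategoryAcyclic C)).isLocalization_of_isLocalizedFullyFaithful
      (L₂ := DerivedCategory.Plus.Qh) (F := boundedToPlus C) (Iso.refl _)

variable (C) in
/-- The class of quasi-isomorphisms between bounded complexes. -/
def qisB : MorphismProperty (ChB C) := (HomologicalComplex.quasiIso C (.up ℤ)).inverseImage (ChB.ι C)

variable (C) in
/-- The localization functor from bounded complexes to the bounded derived category. -/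
noncomputable def QB : ChB C ⥤ Bounded C :=
  t.bounded.lift (ChB.ι C ⋙ DerivedCategory.Q) (fun K => bounded_Q_obj K.obj K.property)

variable (C) in
/-- The functor `QB` factors through the homotopy category of bounded complexes. -/
noncomputable def quotientCompQhBIso : quotientB C ⋙ QhB C ≅ QB C :=
  NatIso.ofComponents (fun K => t.bounded.isoMk ((quotientCompQhIso C).app K.obj))
      (fun f => ObjectProperty.hom_ext _ ((quotientCompQhIso C).hom.naturality f.hom))

lemma isIso_QB_map_iff {K L : ChB C} (f : K ⟶ L) : IsIso ((QB C).map f) ↔ qisB C f := by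
  rw [← isIso_iff_of_reflects_iso _ (Bounded.ι (C := C))]
  exact isIso_Q_map_iff_quasiIso (C := C) f.hom

instance QB_isLocalization : (QB C).IsLocalization (qisB C) := by
  have : (quotientB C ⋙ QhB C).IsLocalization (qisB C) := by
    refine Functor.IsLocalization.comp (quotientB C) (QhB C)
      ((homotopyEquivalences C (.up ℤ)).inverseImage (ChB.ι C))
      ((HomotopyCategory.Plus.subcategoryAcyclic C).inverseImage (bddPlus C).ι).trW _ ?_ ?_ ?_
    · rw [← MorphismProperty.IsInvertedBy.iff_of_iso (qisB C) (quotientCompQhBIso C).symm]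
      exact fun K L f hf => (isIso_QB_map_iff f).2 hf
    · exact fun K L f hf => homotopyEquivalences_le_quasiIso C (.up ℤ) _ hf
    · intro X Y f hf
      let X' := (quotientB C).objPreimage X
      let Y' := (quotientB C).objPreimage Y
      obtain ⟨f', hf'⟩ := (quotientB C).map_surjective
        (((quotientB C).objObjPreimageIso X).hom ≫ f ≫ ((quotientB C).objObjPreimageIso Y).inv)
      let e : Arrow.mk ((quotientB C).map f') ≅ Arrow.mk f :=
        Arrow.isoMk ((quotientB C).objObjPreimageIso X) ((quotientB C).objObjPreimageIso Y)
          (by dsimp; rw [hf']; simp)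
      refine ⟨X', Y', f', ?_, ⟨e⟩⟩
      have h1 : IsIso ((QhB C).map f) := Localization.inverts (QhB C) _ f hf
      have h2 : IsIso ((quotientB C ⋙ QhB C).map f') :=
        ((MorphismProperty.isomorphisms _).arrow_mk_iso_iff ((QhB C).mapArrow.mapIso e)).2 h1
      exact (isIso_QB_map_iff f').1 (((MorphismProperty.isomorphisms _).arrow_mk_iso_iff
        (Arrow.isoOfNatIso (quotientCompQhBIso C) (Arrow.mk f'))).1 h2)
  exact Functor.IsLocalization.of_iso (qisB C) (quotientCompQhBIso C)

end

end Localization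
section QuasiIso

open HomologicalComplex ComposableArrows

variable {C : Type u} [Category.{v} C] [Abelian C]

lemma quasiIso_τ₂ {S₁ S₂ : ShortComplex (CochainComplex C ℤ)} (φ : S₁ ⟶ S₂)
    (hS₁ : S₁.ShortExact) (hS₂ : S₂.ShortExact) (h₁ : QuasiIso φ.τ₁) (h₃ : QuasiIso φ.τ₃) :
    QuasiIso φ.τ₂ := by
  rw [quasiIso_iff]
  intro i
  rw [quasiIsoAt_iff_isIso_homologyMap]
  have : Mono (homologyMap φ.τ₂ i) := by
    apply Abelian.mono_of_epi_of_mono_of_mono ((δ₀Functor ⋙ δ₀Functor).map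
      (HomologySequence.mapComposableArrows₅ φ hS₁ hS₂ (i - 1) i (by simp)))
    · exact (HomologySequence.composableArrows₅_exact hS₁ (i - 1) i (by simp)).δ₀.δ₀
    · exact (HomologySequence.composableArrows₅_exact hS₂ (i - 1) i (by simp)).δ₀.δ₀
    · exact (inferInstance : Epi (homologyMap φ.τ₃ (i - 1)))
    · exact (inferInstance : Mono (homologyMap φ.τ₁ i))
    · exact (inferInstance : Mono (homologyMap φ.τ₃ i))
  have : Epi (homologyMap φ.τ₂ i) := by
    apply Abelian.epi_of_epi_of_epi_of_mono ((δlastFunctor ⋙ δlastFunctor).map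
      (HomologySequence.mapComposableArrows₅ φ hS₁ hS₂ i (i + 1) (by simp)))
    · exact (HomologySequence.composableArrows₅_exact hS₁ i (i + 1) (by simp)).δlast.δlast
    · exact (HomologySequence.composableArrows₅_exact hS₂ i (i + 1) (by simp)).δlast.δlast
    · exact (inferInstance : Epi (homologyMap φ.τ₁ i))
    · exact (inferInstance : Epi (homologyMap φ.τ₃ i))
    · exact (inferInstance : Mono (homologyMap φ.τ₁ (i + 1)))
  exact isIso_of_mono_of_epi _

lemma quasiIso_of_components {P P' L L' : CochainComplex C ℤ} (φ : P ⟶ P') (g : L ⟶ L')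
    [QuasiIso g] (E : C ⥤ C) [E.Additive] [E.PreservesHomology] (m : ℤ) (ε : ℤˣ)
    (a : ∀ n, E.obj (L.X n) ≅ P.X (n + m)) (a' : ∀ n, E.obj (L'.X n) ≅ P'.X (n + m))
    (ha : ∀ n, (a n).hom ≫ P.d (n + m) (n + 1 + m) =
      ε • (E.map (L.d n (n + 1)) ≫ (a (n + 1)).hom))
    (ha' : ∀ n, (a' n).hom ≫ P'.d (n + m) (n + 1 + m) =
      ε • (E.map (L'.d n (n + 1)) ≫ (a' (n + 1)).hom))
    (hφ : ∀ n, (a n).hom ≫ φ.f (n + m) = E.map (g.f n) ≫ (a' n).hom) : QuasiIso φ := by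
  have key (P L : CochainComplex C ℤ) (a : ∀ n, E.obj (L.X n) ≅ P.X (n + m))
      (ha : ∀ n, (a n).hom ≫ P.d (n + m) (n + 1 + m) =
      ε • (E.map (L.d n (n + 1)) ≫ (a (n + 1)).hom)) (n : ℤ) :
      (ε • (a n).hom) ≫ P.d (n + m) (n + 1 + m) = E.map (L.d n (n + 1)) ≫ (a (n + 1)).hom := by
    rw [Linear.units_smul_comp, ha, smul_smul, Int.units_mul_self, one_smul]
  let u (X Y : C) (e : X ≅ Y) : X ≅ Y :=
    { hom := ε • e.hom
      inv := ε • e.inv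
      hom_inv_id := by
        rw [Linear.units_smul_comp, Linear.comp_units_smul, smul_smul, Int.units_mul_self,
          one_smul, e.hom_inv_id]
      inv_hom_id := by
        rw [Linear.units_smul_comp, Linear.comp_units_smul, smul_smul, Int.units_mul_self,
          one_smul, e.inv_hom_id] }
  rw [quasiIso_iff]
  intro i
  obtain ⟨n, rfl⟩ : ∃ n, i = n + 1 + m := ⟨i - 1 - m, by omega⟩
  rw [quasiIsoAt_iff' φ (n + m) (n + 1 + m) (n + 1 + 1 + m) (by simp; omega) (by simp; omega)]
  have hg : ShortComplex.QuasiIso ((shortComplexFunctor' C (ComplexShape.up ℤ) n (n + 1)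
      (n + 1 + 1)).map g) := by
    rw [← quasiIsoAt_iff' g n (n + 1) (n + 1 + 1) (by simp) (by simp)]
    infer_instance
  have hEg : ShortComplex.QuasiIso (E.mapShortComplex.map
    ((shortComplexFunctor' C (ComplexShape.up ℤ) n (n + 1) (n + 1 + 1)).map g)) :=
    inferInstance
  refine ShortComplex.quasiIso_of_arrow_mk_iso (E.mapShortComplex.map
    ((shortComplexFunctor' C (ComplexShape.up ℤ) n (n + 1) (n + 1 + 1)).map g)) _ (Arrow.isoMk
    (ShortComplex.isoMk (u _ _ (a n)) (a (n + 1)) (u _ _ (a (n + 1 + 1))) ?_ ?_)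
    (ShortComplex.isoMk (u _ _ (a' n)) (a' (n + 1)) (u _ _ (a' (n + 1 + 1))) ?_ ?_) ?_)
  · exact key P L a ha n
  · exact (ha (n + 1)).trans (Linear.comp_units_smul _ _ _).symm
  · exact key P' L' a' ha' n
  · exact (ha' (n + 1)).trans (Linear.comp_units_smul _ _ _).symm
  · apply ShortComplex.hom_ext
    · change (ε • (a n).hom) ≫ φ.f _ = E.map (g.f n) ≫ (ε • (a' n).hom)
      rw [Linear.units_smul_comp, Linear.comp_units_smul, hφ]
    · exact hφ (n + 1)
    · change (ε • (a _).hom) ≫ φ.f _ = E.map (g.f _) ≫ (ε • (a' _).hom)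
      rw [Linear.units_smul_comp, Linear.comp_units_smul, hφ]

end QuasiIso
section Flat

open HomologicalComplex

variable {C : Type u} [Category.{v} C] [Abelian C]

lemma isIso_cofan_inj {J : Type} {X : J → C} {c : Cofan X} (hc : IsColimit c) (j : J)
    (hj : ∀ i, i ≠ j → IsZero (X i)) : IsIso (c.inj j) :=
  ⟨cofanProj hc j, inj_cofanProj_self hc j, by
    have := sum_cofanProj hc {j} (fun i hi => hj i (by simpa using hi))
    simpa using this⟩

variable [MonoidalCategory C] [MonoidalPreadditive C]

lemma isIso_ι_left (X Y : GradedObject ℤ C) [GradedObject.HasTensor X Y] (m n j : ℤ)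
    (h : m + n = j) (hX : ∀ i, i ≠ m → IsZero (X i)) :
    IsIso (GradedObject.Monoidal.ιTensorObj X Y m n j h) := by
  refine isIso_cofan_inj (GradedObject.isColimitCofanMapObj
    (((GradedObject.mapBifunctor (curriedTensor C) ℤ ℤ).obj X).obj Y)
    (fun (x : ℤ × ℤ) => x.1 + x.2) j) ⟨⟨m, n⟩, h⟩ ?_
  rintro ⟨⟨i, i'⟩, hi⟩ hne
  refine isZero_tensor_left (hX _ (fun hm => hne ?_)) _
  dsimp at hm hi
  obtain rfl : i' = n := by
    change i + i' = j at hi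
    omega
  subst hm
  rfl

lemma isIso_ι_right (X Y : GradedObject ℤ C) [GradedObject.HasTensor X Y] (m n j : ℤ)
    (h : n + m = j) (hY : ∀ i, i ≠ m → IsZero (Y i)) :
    IsIso (GradedObject.Monoidal.ιTensorObj X Y n m j h) := by
  refine isIso_cofan_inj (GradedObject.isColimitCofanMapObj
    (((GradedObject.mapBifunctor (curriedTensor C) ℤ ℤ).obj X).obj Y)
    (fun (x : ℤ × ℤ) => x.1 + x.2) j) ⟨⟨n, m⟩, h⟩ ?_
  rintro ⟨⟨i, i'⟩, hi⟩ hne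
  refine isZero_tensor_right _ (hY _ (fun hm => hne ?_))
  dsimp at hm hi
  obtain rfl : i = n := by
    change i + i' = j at hi
    omega
  subst hm
  rfl

/-- The tensor product is exact in each variable. -/
class BiexactTensor (C : Type u) [Category.{v} C] [Abelian C] [MonoidalCategory C]
    [MonoidalPreadditive C] : Prop where
  left (X : C) : (tensorLeft X).PreservesHomology
  right (X : C) : (tensorRight X).PreservesHomology

instance [RigidCategory C] : BiexactTensor C where
  left X := by
    have h1 : (tensorLeft X).IsLeftAdjoint := (tensorLeftAdjunction (ᘁX) X).isLeftAdjoint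
    have h2 : (tensorLeft X).IsRightAdjoint := (tensorLeftAdjunction X (Xᘁ)).isRightAdjoint
    infer_instance
  right X := by
    have h1 : (tensorRight X).IsLeftAdjoint := (tensorRightAdjunction X (Xᘁ)).isLeftAdjoint
    have h2 : (tensorRight X).IsRightAdjoint := (tensorRightAdjunction (ᘁX) X).isRightAdjoint
    infer_instance

lemma ι_tensor_d_left (K L : ChB C) (m n : ℤ) (hK : ∀ i, i ≠ m → IsZero (K.obj.X i)) :
    ιTensorObj K.obj L.obj m n (n + m) (add_comm m n) ≫
      (tensorObj K.obj L.obj).d (n + m) (n + 1 + m) =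
    ((-1) ^ m : ℤˣ) • ((tensorLeft (K.obj.X m)).map (L.obj.d n (n + 1)) ≫
      ιTensorObj K.obj L.obj m (n + 1) (n + 1 + m) (add_comm m (n + 1))) := by
  rw [mapBifunctor.d_eq, Preadditive.comp_add, mapBifunctor.ι_D₁, mapBifunctor.ι_D₂,
    mapBifunctor.d₁_eq' _ _ _ _ (i₁' := m + 1) (by simp),
    mapBifunctor.d₂_eq _ _ _ _ m (i₂' := n + 1) (by simp) _ (add_comm m (n + 1))]
  have h0 : IsZero (((curriedTensor C).obj (K.obj.X (m + 1))).obj (L.obj.X n)) :=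
    isZero_tensor_left (hK _ (by omega)) _
  rw [h0.eq_of_tgt (((curriedTensor C).map (K.obj.d m (m + 1))).app (L.obj.X n)) 0, zero_comp,
    smul_zero, zero_add]
  rfl

lemma ι_tensor_d_right (K L : ChB C) (m n : ℤ) (hL : ∀ i, i ≠ m → IsZero (L.obj.X i)) :
    ιTensorObj K.obj L.obj n m (n + m) rfl ≫
      (tensorObj K.obj L.obj).d (n + m) (n + 1 + m) =
    (1 : ℤˣ) • ((tensorRight (L.obj.X m)).map (K.obj.d n (n + 1)) ≫
      ιTensorObj K.obj L.obj (n + 1) m (n + 1 + m) rfl) := by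
  rw [mapBifunctor.d_eq, Preadditive.comp_add, mapBifunctor.ι_D₁, mapBifunctor.ι_D₂,
    mapBifunctor.d₁_eq _ _ _ _ (i₁' := n + 1) (by simp) m (n + 1 + m) rfl,
    mapBifunctor.d₂_eq' _ _ _ _ n (i₂' := m + 1) (by simp) _]
  have h0 : IsZero (((curriedTensor C).obj (K.obj.X n)).obj (L.obj.X (m + 1))) :=
    isZero_tensor_right _ (hL _ (by omega))
  rw [h0.eq_of_tgt (((curriedTensor C).obj (K.obj.X n)).map (L.obj.d m (m + 1))) 0, zero_comp,
    smul_zero, add_zero]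
  rfl

variable [BiexactTensor C]

lemma quasiIso_whiskerLeft_base (K : ChB C) {L L' : ChB C} (g : L ⟶ L') (hg : qisB C g) (m : ℤ)
    (hK : ∀ i, i ≠ m → IsZero (K.obj.X i)) : qisB C (K ◁ g) := by
  have := BiexactTensor.left (K.obj.X m)
  have hg' : QuasiIso g.hom := hg
  have h1 (n : ℤ) := isIso_ι_left K.obj.X L.obj.X m n (n + m) (add_comm m n) hK
  have h2 (n : ℤ) := isIso_ι_left K.obj.X L'.obj.X m n (n + m) (add_comm m n) hK
  refine quasiIso_of_components (K ◁ g).hom g.hom (tensorLeft (K.obj.X m)) m ((-1) ^ m)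
    (fun n => @asIso _ _ _ _ _ (h1 n)) (fun n => @asIso _ _ _ _ _ (h2 n))
    (fun n => ι_tensor_d_left K L m n hK) (fun n => ι_tensor_d_left K L' m n hK) (fun n => ?_)
  refine (GradedObject.Monoidal.ι_tensorHom (𝟙 K.obj.X) g.hom.f m n (n + m)
    (add_comm m n)).trans ?_
  change (𝟙 (K.obj.X m) ⊗ₘ g.hom.f n) ≫ _ = _
  rw [id_tensorHom]
  rfl

lemma quasiIso_whiskerRight_base {K K' : ChB C} (g : K ⟶ K') (hg : qisB C g) (L : ChB C) (m : ℤ)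
    (hL : ∀ i, i ≠ m → IsZero (L.obj.X i)) : qisB C (g ▷ L) := by
  have := BiexactTensor.right (L.obj.X m)
  have hg' : QuasiIso g.hom := hg
  have h1 (n : ℤ) := isIso_ι_right K.obj.X L.obj.X m n (n + m) rfl hL
  have h2 (n : ℤ) := isIso_ι_right K'.obj.X L.obj.X m n (n + m) rfl hL
  refine quasiIso_of_components (g ▷ L).hom g.hom (tensorRight (L.obj.X m)) m 1
    (fun n => @asIso _ _ _ _ _ (h1 n)) (fun n => @asIso _ _ _ _ _ (h2 n))
    (fun n => ι_tensor_d_right K L m n hL) (fun n => ι_tensor_d_right K' L m n hL) (fun n => ?_)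
  refine (GradedObject.Monoidal.ι_tensorHom g.hom.f (𝟙 L.obj.X) n m (n + m) rfl).trans ?_
  change (g.hom.f n ⊗ₘ 𝟙 (L.obj.X m)) ≫ _ = _
  rw [tensorHom_id]
  rfl

end Flat
section Devissage

open HomologicalComplex

variable {C : Type u} [Category.{v} C] [Abelian C]

/-- A bounded complex supported in degrees `≥ a` is a degreewise split extension of its term
in degree `a` by a complex supported in degrees `> a`. -/
structure Devissage (K : ChB C) (a : ℤ) where
  /-- the subcomplex -/
  K₁ : ChB C
  /-- the quotient complex -/
  K₃ : ChB C
  /-- the inclusion -/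
  f : K₁ ⟶ K
  /-- the projection -/
  g : K ⟶ K₃
  /-- a degreewise retraction -/
  r : (K.obj.X : GradedObject ℤ C) ⟶ K₁.obj.X
  /-- a degreewise section -/
  s : (K₃.obj.X : GradedObject ℤ C) ⟶ K.obj.X
  fg : f ≫ g = 0
  fr : ∀ i, f.hom.f i ≫ r i = 𝟙 _
  sg : ∀ i, s i ≫ g.hom.f i = 𝟙 _
  rfgs : ∀ i, r i ≫ f.hom.f i + g.hom.f i ≫ s i = 𝟙 _
  zero₁ : ∀ i, i ≤ a → IsZero (K₁.obj.X i)
  zero₁' : ∀ i, IsZero (K.obj.X i) → IsZero (K₁.obj.X i)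
  zero₃ : ∀ i, i ≠ a → IsZero (K₃.obj.X i)

lemma exists_devissage (K : ChB C) (a : ℤ) (hK : ∀ i, i < a → IsZero (K.obj.X i)) :
    Nonempty (Devissage K a) := by
  classical
  let S : CochainComplex C ℤ := (single C (ComplexShape.up ℤ) a).obj (K.obj.X a)
  have hS (i : ℤ) (hi : i ≠ a) : IsZero (S.X i) := isZero_single_obj_X _ _ _ _ hi
  let p : K.obj ⟶ S := mkHomToSingle (𝟙 _) (fun i hi => by
    simp only [ComplexShape.up_Rel] at hi
    exact (hK i (by omega)).eq_of_src _ _)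
  have hpa : IsIso (p.f a) := by
    dsimp only [p]
    rw [mkHomToSingle_f]
    infer_instance
  have hp (i : ℤ) (hi : i ≠ a) : p.f i = 0 := (hS i hi).eq_of_tgt _ _
  let s : ∀ i, S.X i ⟶ K.obj.X i := fun i => if h : i = a then
    eqToHom (by rw [h]) ≫ inv (p.f a) ≫ eqToHom (by rw [h]) else 0
  have hs (i : ℤ) : s i ≫ p.f i = 𝟙 _ := by
    by_cases hi : i = a
    · subst hi
      simp [s]
    · exact (hS i hi).eq_of_src _ _
  have hepi (i : ℤ) : Epi (p.f i) := by
    have : IsSplitEpi (p.f i) := ⟨⟨⟨s i, hs i⟩⟩⟩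
    infer_instance
  have hpe : Epi p := epi_of_epi_f p hepi
  let T : ShortComplex (CochainComplex C ℤ) := ShortComplex.mk (kernel.ι p) p (kernel.condition p)
  have hT : T.ShortExact :=
    { exact := ShortComplex.exact_of_f_is_kernel _ (kernelIsKernel p)
      mono_f := inferInstanceAs (Mono (kernel.ι p))
      epi_g := hpe }
  have hTi (i : ℤ) : (T.map (eval C (ComplexShape.up ℤ) i)).ShortExact :=
    hT.map_of_exact (eval C (ComplexShape.up ℤ) i)
  let σ (i : ℤ) : (T.map (eval C (ComplexShape.up ℤ) i)).Splitting :=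
    ShortComplex.Splitting.ofExactOfSection _ (hTi i).exact (s i) (hs i) (hTi i).mono_f
  have hz (i : ℤ) (hi : IsZero (K.obj.X i)) : IsZero ((kernel p).X i) := by
    have : Mono ((kernel.ι p).f i) := (hTi i).mono_f
    exact hi.of_mono ((kernel.ι p).f i)
  have hza : IsZero ((kernel p).X a) := by
    have : Mono ((kernel.ι p).f a) := (hTi a).mono_f
    have h0 : (kernel.ι p).f a ≫ p.f a = 0 := by
      rw [← comp_f, kernel.condition, zero_f]
    have h1 : (kernel.ι p).f a = 0 := by
      rw [← cancel_mono (p.f a), h0, zero_comp]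
    rw [IsZero.iff_id_eq_zero, ← cancel_mono ((kernel.ι p).f a), h1, comp_zero, comp_zero]
  obtain ⟨b, c, hbc⟩ := K.property
  exact ⟨
    { K₁ := ⟨kernel p, b, c, fun i hi => hz i (hbc i hi)⟩
      K₃ := ⟨S, a, a, fun i hi => hS i (fun h => hi (by simp [h]))⟩
      f := ObjectProperty.homMk (kernel.ι p)
      g := ObjectProperty.homMk p
      r := fun i => (σ i).r
      s := s
      fg := ObjectProperty.hom_ext _ (kernel.condition p)
      fr := fun i => (σ i).f_r
      sg := hs
      rfgs := fun i => (σ i).id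
      zero₁ := fun i hi => by
        rcases hi.lt_or_eq with h | rfl
        · exact hz i (hK i h)
        · exact hza
      zero₁' := hz
      zero₃ := hS }⟩

variable [MonoidalCategory C] [MonoidalPreadditive C]

lemma ι_wR {X X' : GradedObject ℤ C} (f : X ⟶ X') (Y : GradedObject ℤ C)
    [GradedObject.HasTensor X Y] [GradedObject.HasTensor X' Y] (i j n : ℤ) (h : i + j = n) :
    GradedObject.Monoidal.ιTensorObj X Y i j n h ≫ GradedObject.Monoidal.whiskerRight f Y n =
      f i ▷ Y j ≫ GradedObject.Monoidal.ιTensorObj X' Y i j n h := by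
  refine (GradedObject.Monoidal.ι_tensorHom f (𝟙 Y) i j n h).trans ?_
  change (f i ⊗ₘ 𝟙 (Y j)) ≫ _ = _
  rw [tensorHom_id]

lemma ι_wL {X X' : GradedObject ℤ C} (f : X ⟶ X') (Y : GradedObject ℤ C)
    [GradedObject.HasTensor Y X] [GradedObject.HasTensor Y X'] (i j n : ℤ) (h : i + j = n) :
    GradedObject.Monoidal.ιTensorObj Y X i j n h ≫ GradedObject.Monoidal.whiskerLeft Y f n =
      Y i ◁ f j ≫ GradedObject.Monoidal.ιTensorObj Y X' i j n h := by
  refine (GradedObject.Monoidal.ι_tensorHom (𝟙 Y) f i j n h).trans ?_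
  change (𝟙 (Y i) ⊗ₘ f j) ≫ _ = _
  rw [id_tensorHom]

lemma ι_wR₂ {X X' X'' : GradedObject ℤ C} (f : X ⟶ X') (g : X' ⟶ X'') (Y : GradedObject ℤ C)
    [GradedObject.HasTensor X Y] [GradedObject.HasTensor X' Y] [GradedObject.HasTensor X'' Y]
    (i j n : ℤ) (h : i + j = n) :
    GradedObject.Monoidal.ιTensorObj X Y i j n h ≫ GradedObject.Monoidal.whiskerRight f Y n ≫
      GradedObject.Monoidal.whiskerRight g Y n =
      (f i ≫ g i) ▷ Y j ≫ GradedObject.Monoidal.ιTensorObj X'' Y i j n h := by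
  rw [← Category.assoc, ι_wR, Category.assoc, ι_wR, ← comp_whiskerRight_assoc]

lemma ι_wL₂ {X X' X'' : GradedObject ℤ C} (f : X ⟶ X') (g : X' ⟶ X'') (Y : GradedObject ℤ C)
    [GradedObject.HasTensor Y X] [GradedObject.HasTensor Y X'] [GradedObject.HasTensor Y X'']
    (i j n : ℤ) (h : i + j = n) :
    GradedObject.Monoidal.ιTensorObj Y X i j n h ≫ GradedObject.Monoidal.whiskerLeft Y f n ≫
      GradedObject.Monoidal.whiskerLeft Y g n =
      Y i ◁ (f j ≫ g j) ≫ GradedObject.Monoidal.ιTensorObj Y X'' i j n h := by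
  rw [← Category.assoc, ι_wL, Category.assoc, ι_wL, ← whiskerLeft_comp_assoc]

lemma splitting_right (X₁ X₂ X₃ Y : GradedObject ℤ C) [GrBounded X₁] [GrBounded X₂]
    [GrBounded X₃] [GrBounded Y] (f : X₁ ⟶ X₂) (g : X₂ ⟶ X₃) (r : X₂ ⟶ X₁) (s : X₃ ⟶ X₂)
    (fg : ∀ i, f i ≫ g i = 0) (fr : ∀ i, f i ≫ r i = 𝟙 _) (sg : ∀ i, s i ≫ g i = 𝟙 _)
    (id : ∀ i, r i ≫ f i + g i ≫ s i = 𝟙 _) (n : ℤ) :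
    ∃ (h : GradedObject.Monoidal.whiskerRight f Y n ≫
      GradedObject.Monoidal.whiskerRight g Y n = 0), (ShortComplex.mk _ _ h).ShortExact := by
  have h : GradedObject.Monoidal.whiskerRight f Y n ≫
      GradedObject.Monoidal.whiskerRight g Y n = 0 := by
    refine GradedObject.Monoidal.tensorObj_ext _ _ (fun i j hij => ?_)
    rw [ι_wR₂, fg, comp_zero,
      MonoidalPreadditive.zero_whiskerRight, zero_comp]
  refine ⟨h, ShortComplex.Splitting.shortExact
    { r := GradedObject.Monoidal.whiskerRight r Y n
      s := GradedObject.Monoidal.whiskerRight s Y n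
      f_r := ?_
      s_g := ?_
      id := ?_ }⟩
  · refine GradedObject.Monoidal.tensorObj_ext _ _ (fun i j hij => ?_)
    dsimp only
    rw [ι_wR₂, fr,
      id_whiskerRight, Category.id_comp, Category.comp_id]
  · refine GradedObject.Monoidal.tensorObj_ext _ _ (fun i j hij => ?_)
    dsimp only
    rw [ι_wR₂, sg,
      id_whiskerRight, Category.id_comp, Category.comp_id]
  · refine GradedObject.Monoidal.tensorObj_ext _ _ (fun i j hij => ?_)
    dsimp only
    rw [Preadditive.comp_add, ι_wR₂, ι_wR₂, ← Preadditive.add_comp, ← MonoidalPreadditive.add_whiskerRight,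
      id, id_whiskerRight, Category.id_comp, Category.comp_id]

lemma splitting_left (X₁ X₂ X₃ Y : GradedObject ℤ C) [GrBounded X₁] [GrBounded X₂]
    [GrBounded X₃] [GrBounded Y] (f : X₁ ⟶ X₂) (g : X₂ ⟶ X₃) (r : X₂ ⟶ X₁) (s : X₃ ⟶ X₂)
    (fg : ∀ i, f i ≫ g i = 0) (fr : ∀ i, f i ≫ r i = 𝟙 _) (sg : ∀ i, s i ≫ g i = 𝟙 _)
    (id : ∀ i, r i ≫ f i + g i ≫ s i = 𝟙 _) (n : ℤ) :
    ∃ (h : GradedObject.Monoidal.whiskerLeft Y f n ≫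
      GradedObject.Monoidal.whiskerLeft Y g n = 0), (ShortComplex.mk _ _ h).ShortExact := by
  have h : GradedObject.Monoidal.whiskerLeft Y f n ≫
      GradedObject.Monoidal.whiskerLeft Y g n = 0 := by
    refine GradedObject.Monoidal.tensorObj_ext _ _ (fun i j hij => ?_)
    rw [ι_wL₂, fg, comp_zero,
      MonoidalPreadditive.whiskerLeft_zero, zero_comp]
  refine ⟨h, ShortComplex.Splitting.shortExact
    { r := GradedObject.Monoidal.whiskerLeft Y r n
      s := GradedObject.Monoidal.whiskerLeft Y s n
      f_r := ?_
      s_g := ?_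
      id := ?_ }⟩
  · refine GradedObject.Monoidal.tensorObj_ext _ _ (fun i j hij => ?_)
    dsimp only
    rw [ι_wL₂, fr,
      whiskerLeft_id, Category.id_comp, Category.comp_id]
  · refine GradedObject.Monoidal.tensorObj_ext _ _ (fun i j hij => ?_)
    dsimp only
    rw [ι_wL₂, sg,
      whiskerLeft_id, Category.id_comp, Category.comp_id]
  · refine GradedObject.Monoidal.tensorObj_ext _ _ (fun i j hij => ?_)
    dsimp only
    rw [Preadditive.comp_add, ι_wL₂, ι_wL₂, ← Preadditive.add_comp, ← MonoidalPreadditive.whiskerLeft_add,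
      id, whiskerLeft_id, Category.id_comp, Category.comp_id]

lemma Devissage.shortExact_right {K : ChB C} {a : ℤ} (D : Devissage K a) (L : ChB C) :
    ∃ (h : (D.f ▷ L).hom ≫ (D.g ▷ L).hom = 0), (ShortComplex.mk _ _ h).ShortExact := by
  have H := splitting_right D.K₁.obj.X K.obj.X D.K₃.obj.X L.obj.X D.f.hom.f D.g.hom.f D.r D.s
    (fun i => congrArg (fun t => t.hom.f i) D.fg) D.fr D.sg D.rfgs
  have h : (D.f ▷ L).hom ≫ (D.g ▷ L).hom = 0 := by
    ext n : 1
    exact (H n).choose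
  exact ⟨h, shortExact_of_degreewise_shortExact _ (fun n => (H n).choose_spec)⟩

lemma Devissage.shortExact_left {K : ChB C} {a : ℤ} (D : Devissage K a) (L : ChB C) :
    ∃ (h : (L ◁ D.f).hom ≫ (L ◁ D.g).hom = 0), (ShortComplex.mk _ _ h).ShortExact := by
  have H := splitting_left D.K₁.obj.X K.obj.X D.K₃.obj.X L.obj.X D.f.hom.f D.g.hom.f D.r D.s
    (fun i => congrArg (fun t => t.hom.f i) D.fg) D.fr D.sg D.rfgs
  have h : (L ◁ D.f).hom ≫ (L ◁ D.g).hom = 0 := by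
    ext n : 1
    exact (H n).choose
  exact ⟨h, shortExact_of_degreewise_shortExact _ (fun n => (H n).choose_spec)⟩

variable [BiexactTensor C]

lemma quasiIso_whiskerLeft (K : ChB C) {L L' : ChB C} (g : L ⟶ L') (hg : qisB C g) :
    qisB C (K ◁ g) := by
  obtain ⟨a, b, hab⟩ := K.property
  have key : ∀ (N : ℕ) (a : ℤ) (K : ChB C), (∀ i, i ∉ Set.Icc a (a + N) → IsZero (K.obj.X i)) →
      qisB C (K ◁ g) := by
    intro N
    induction N with
    | zero =>
      intro a K hK
      exact quasiIso_whiskerLeft_base K g hg a (fun i hi => hK i (fun h => hi (by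
        simp only [Set.mem_Icc] at h; omega)))
    | succ N ih =>
      intro a K hK
      obtain ⟨D⟩ := exists_devissage K a (fun i hi => hK i (fun h => by
        simp only [Set.mem_Icc] at h; omega))
      obtain ⟨h, hS⟩ := D.shortExact_right L
      obtain ⟨h', hS'⟩ := D.shortExact_right L'
      let φ : ShortComplex.mk _ _ h ⟶ ShortComplex.mk _ _ h' :=
        { τ₁ := (D.K₁ ◁ g).hom
          τ₂ := (K ◁ g).hom
          τ₃ := (D.K₃ ◁ g).hom
          comm₁₂ := congrArg (fun t => t.hom) (whisker_exchange D.f g)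
          comm₂₃ := congrArg (fun t => t.hom) (whisker_exchange D.g g) }
      refine quasiIso_τ₂ φ hS hS' (ih (a + 1) D.K₁ (fun i hi => ?_))
        (quasiIso_whiskerLeft_base D.K₃ g hg a D.zero₃)
      by_cases hi' : i ≤ a
      · exact D.zero₁ i hi'
      · exact D.zero₁' i (hK i (fun h => hi (by
          simp only [Set.mem_Icc] at h ⊢; push_cast at h; omega)))
  refine key (b - a).toNat a K (fun i hi => hab i (fun h => hi ?_))
  simp only [Set.mem_Icc] at h ⊢
  omega

lemma quasiIso_whiskerRight {L L' : ChB C} (g : L ⟶ L') (hg : qisB C g) (K : ChB C) :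
    qisB C (g ▷ K) := by
  obtain ⟨a, b, hab⟩ := K.property
  have key : ∀ (N : ℕ) (a : ℤ) (K : ChB C), (∀ i, i ∉ Set.Icc a (a + N) → IsZero (K.obj.X i)) →
      qisB C (g ▷ K) := by
    intro N
    induction N with
    | zero =>
      intro a K hK
      exact quasiIso_whiskerRight_base g hg K a (fun i hi => hK i (fun h => hi (by
        simp only [Set.mem_Icc] at h; omega)))
    | succ N ih =>
      intro a K hK
      obtain ⟨D⟩ := exists_devissage K a (fun i hi => hK i (fun h => by
        simp only [Set.mem_Icc] at h; omega))
      obtain ⟨h, hS⟩ := D.shortExact_left L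
      obtain ⟨h', hS'⟩ := D.shortExact_left L'
      let φ : ShortComplex.mk _ _ h ⟶ ShortComplex.mk _ _ h' :=
        { τ₁ := (g ▷ D.K₁).hom
          τ₂ := (g ▷ K).hom
          τ₃ := (g ▷ D.K₃).hom
          comm₁₂ := congrArg (fun t => t.hom) (whisker_exchange g D.f).symm
          comm₂₃ := congrArg (fun t => t.hom) (whisker_exchange g D.g).symm }
      refine quasiIso_τ₂ φ hS hS' (ih (a + 1) D.K₁ (fun i hi => ?_))
        (quasiIso_whiskerRight_base g hg D.K₃ a D.zero₃)
      by_cases hi' : i ≤ a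
      · exact D.zero₁ i hi'
      · exact D.zero₁' i (hK i (fun h => hi (by
          simp only [Set.mem_Icc] at h ⊢; push_cast at h; omega)))
  refine key (b - a).toNat a K (fun i hi => hab i (fun h => hi ?_))
  simp only [Set.mem_Icc] at h ⊢
  omega

instance : (qisB C).IsMultiplicative := by
  dsimp only [qisB]
  infer_instance

instance qisB_isMonoidal : (qisB C).IsMonoidal where
  whiskerLeft K _ _ g hg := quasiIso_whiskerLeft K g hg
  whiskerRight g hg K := quasiIso_whiskerRight g hg K

end Devissage
section Single

open HomologicalComplex

variable (C : Type u) [Category.{v} C] [Abelian C]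

/-- Objects of `C` as complexes concentrated in degree zero. -/
noncomputable def singleB : C ⥤ ChB C :=
  (bddProp C).lift (single C (ComplexShape.up ℤ) 0) (fun X => ⟨0, 0, fun i hi =>
    isZero_single_obj_X _ _ _ _ (fun h => hi (by simp [h]))⟩)

variable {C}

/-- The identification of `X` with the degree zero term of its single complex. -/
noncomputable def sg (X : C) : X ≅ ((singleB C).obj X).obj.X 0 :=
  (singleObjXSelf (ComplexShape.up ℤ) 0 X).symm

lemma sg_map {X Y : C} (f : X ⟶ Y) :
    (sg X).hom ≫ ((singleB C).map f).hom.f 0 = f ≫ (sg Y).hom := by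
  change (singleObjXSelf (ComplexShape.up ℤ) 0 X).inv ≫ ((single C (ComplexShape.up ℤ) 0).map f).f 0
    = f ≫ (singleObjXSelf (ComplexShape.up ℤ) 0 Y).inv
  rw [single_map_f_self, Iso.inv_hom_id_assoc]

lemma singleB_hom_ext {X : C} {K : ChB C} {f g : (singleB C).obj X ⟶ K}
    (h : (sg X).hom ≫ f.hom.f 0 = (sg X).hom ≫ g.hom.f 0) : f = g :=
  ObjectProperty.hom_ext _ (from_single_hom_ext ((cancel_epi (sg X).hom).1 h))

variable [MonoidalCategory C] [MonoidalPreadditive C]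

/-- The inclusion of a summand in the degree zero term of a tensor product. -/
noncomputable def ιB (K L : ChB C) : K.obj.X 0 ⊗ L.obj.X 0 ⟶ (K ⊗ L).obj.X 0 :=
  GradedObject.Monoidal.ιTensorObj K.obj.X L.obj.X 0 0 0 (add_zero 0)

lemma ιB_whiskerRight {K K' : ChB C} (f : K ⟶ K') (L : ChB C) :
    ιB K L ≫ (f ▷ L).hom.f 0 = f.hom.f 0 ▷ L.obj.X 0 ≫ ιB K' L :=
  ι_wR f.hom.f L.obj.X 0 0 0 (add_zero 0)

lemma ιB_whiskerLeft {K K' : ChB C} (f : K ⟶ K') (L : ChB C) :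
    ιB L K ≫ (L ◁ f).hom.f 0 = L.obj.X 0 ◁ f.hom.f 0 ≫ ιB L K' :=
  ι_wL f.hom.f L.obj.X 0 0 0 (add_zero 0)

lemma ιB_associator (K L M : ChB C) :
    ιB K L ▷ M.obj.X 0 ≫ ιB (K ⊗ L) M ≫ (α_ K L M).hom.hom.f 0 =
      (α_ (K.obj.X 0) (L.obj.X 0) (M.obj.X 0)).hom ≫ K.obj.X 0 ◁ ιB L M ≫ ιB K (L ⊗ M) := by
  have h3 := GradedObject.Monoidal.ιTensorObj₃'_associator_hom K.obj.X L.obj.X M.obj.X 0 0 0 0 rfl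
  rw [GradedObject.Monoidal.ιTensorObj₃'_eq K.obj.X L.obj.X M.obj.X 0 0 0 0 rfl 0 rfl,
    GradedObject.Monoidal.ιTensorObj₃_eq K.obj.X L.obj.X M.obj.X 0 0 0 0 rfl 0 rfl,
    Category.assoc] at h3
  exact h3

/-- The inverse of the left unitor. -/
noncomputable def lamInv (K : ChB C) : K ⟶ (singleB C).obj (𝟙_ C) ⊗ K := (λ_ K).inv

/-- The inverse of the right unitor. -/
noncomputable def rhoInv (K : ChB C) : K ⟶ K ⊗ (singleB C).obj (𝟙_ C) := (ρ_ K).inv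

lemma lamInv_zero (K : ChB C) :
    (lamInv K).hom.f 0 = (λ_ (K.obj.X 0)).inv ≫ (sg (𝟙_ C)).hom ▷ K.obj.X 0 ≫ ιB _ K :=
  leftUnitor'_inv K.obj 0

lemma rhoInv_zero (K : ChB C) :
    (rhoInv K).hom.f 0 = (ρ_ (K.obj.X 0)).inv ≫ K.obj.X 0 ◁ (sg (𝟙_ C)).hom ≫ ιB K _ :=
  rightUnitor'_inv K.obj 0

/-- The degree zero component of the comparison morphism `singleδ`. -/
noncomputable def singleδ₀ (X Y : C) :
    X ⊗ Y ⟶ ((singleB C).obj X ⊗ (singleB C).obj Y).obj.X 0 :=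
  ((sg X).hom ⊗ₘ (sg Y).hom) ≫ ιB _ _

lemma isZero_tensor_single (X Y : C) (n : ℤ) (hn : n ≠ 0) :
    IsZero (((singleB C).obj X ⊗ (singleB C).obj Y).obj.X n) := by
  rw [IsZero.iff_id_eq_zero]
  refine GradedObject.Monoidal.tensorObj_ext (X₁ := ((singleB C).obj X).obj.X)
    (X₂ := ((singleB C).obj Y).obj.X) _ _ (fun i j hij => IsZero.eq_of_src ?_ _ _)
  by_cases hi : i = 0
  · exact isZero_tensor_right _ (isZero_single_obj_X _ _ _ _ (by omega))
  · exact isZero_tensor_left (isZero_single_obj_X _ _ _ _ hi) _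

lemma singleδ₀_d (X Y : C) (k : ℤ) (hk : (ComplexShape.up ℤ).Rel 0 k) :
    singleδ₀ X Y ≫ ((singleB C).obj X ⊗ (singleB C).obj Y).obj.d 0 k = 0 :=
  (isZero_tensor_single X Y k (by
    simp only [ComplexShape.up_Rel] at hk; omega)).eq_of_tgt _ _

/-- The single complex functor is compatible with tensor products. -/
noncomputable def singleδ (X Y : C) :
    (singleB C).obj (X ⊗ Y) ⟶ (singleB C).obj X ⊗ (singleB C).obj Y :=
  ObjectProperty.homMk (mkHomFromSingle (singleδ₀ X Y) (singleδ₀_d X Y))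

lemma sg_singleδ (X Y : C) :
    (sg (X ⊗ Y)).hom ≫ (singleδ X Y).hom.f 0 = ((sg X).hom ⊗ₘ (sg Y).hom) ≫ ιB _ _ :=
  (congrArg (fun t => (sg (X ⊗ Y)).hom ≫ t)
    (mkHomFromSingle_f (singleδ₀ X Y) (singleδ₀_d X Y))).trans
    ((sg (X ⊗ Y)).hom_inv_id_assoc _)

instance (X Y : C) : IsIso (singleδ X Y) := by
  have h0 : IsIso ((singleδ X Y).hom.f 0) := by
    have h1 : IsIso (ιB ((singleB C).obj X) ((singleB C).obj Y)) :=
      isIso_ι_left ((singleB C).obj X).obj.X ((singleB C).obj Y).obj.X 0 0 0 (add_zero 0)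
        (fun i hi => isZero_single_obj_X _ _ _ _ hi)
    have h2 : IsIso (((sg X).hom ⊗ₘ (sg Y).hom) ≫ ιB ((singleB C).obj X) ((singleB C).obj Y)) :=
      inferInstance
    rw [← sg_singleδ] at h2
    exact IsIso.of_isIso_comp_left (sg (X ⊗ Y)).hom _
  have h (n : ℤ) : IsIso ((singleδ X Y).hom.f n) := by
    by_cases hn : n = 0
    · subst hn
      exact h0
    · have h2 : IsZero (((singleB C).obj (X ⊗ Y)).obj.X n) := isZero_single_obj_X _ _ _ _ hn
      have h3 := isZero_tensor_single X Y n hn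
      exact ⟨0, h2.eq_of_src _ _, h3.eq_of_src _ _⟩
  have : IsIso (singleδ X Y).hom := Hom.isIso_of_components _
  have : IsIso ((ChB.ι C).map (singleδ X Y)) := this
  exact isIso_of_fully_faithful (ChB.ι C) _

noncomputable instance : (singleB C).OplaxMonoidal where
  η := 𝟙 _
  δ := singleδ
  δ_natural_left {X Y} f X' := singleB_hom_ext (by
    change (sg (X ⊗ X')).hom ≫ (singleδ X X').hom.f 0 ≫ _ =
      (sg (X ⊗ X')).hom ≫ ((singleB C).map (f ▷ X')).hom.f 0 ≫ (singleδ Y X').hom.f 0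
    rw [← Category.assoc, sg_singleδ, ← Category.assoc (sg _).hom, sg_map, Category.assoc,
      Category.assoc, sg_singleδ, ιB_whiskerRight]
    simp only [← Category.assoc, ← tensorHom_id, tensorHom_comp_tensorHom, sg_map,
      Category.id_comp, Category.comp_id])
  δ_natural_right {X Y} X' f := singleB_hom_ext (by
    change (sg (X' ⊗ X)).hom ≫ (singleδ X' X).hom.f 0 ≫ _ =
      (sg (X' ⊗ X)).hom ≫ ((singleB C).map (X' ◁ f)).hom.f 0 ≫ (singleδ X' Y).hom.f 0
    rw [← Category.assoc, sg_singleδ, ← Category.assoc (sg _).hom, sg_map, Category.assoc,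
      Category.assoc, sg_singleδ, ιB_whiskerLeft]
    simp only [← Category.assoc, ← id_tensorHom, tensorHom_comp_tensorHom, sg_map,
      Category.id_comp, Category.comp_id])
  oplax_associativity X Y Z := singleB_hom_ext (by
    change (sg ((X ⊗ Y) ⊗ Z)).hom ≫ (singleδ (X ⊗ Y) Z).hom.f 0 ≫
        (singleδ X Y ▷ (singleB C).obj Z).hom.f 0 ≫ (α_ ((singleB C).obj X) ((singleB C).obj Y)
          ((singleB C).obj Z)).hom.hom.f 0 =
      (sg ((X ⊗ Y) ⊗ Z)).hom ≫ ((singleB C).map (α_ X Y Z).hom).hom.f 0 ≫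
        (singleδ X (Y ⊗ Z)).hom.f 0 ≫ ((singleB C).obj X ◁ singleδ Y Z).hom.f 0
    have e1 : ((sg (X ⊗ Y)).hom ⊗ₘ (sg Z).hom) ≫ (singleδ X Y).hom.f 0 ▷ _ =
        (((sg X).hom ⊗ₘ (sg Y).hom) ⊗ₘ (sg Z).hom) ≫ ιB _ _ ▷ _ := by
      rw [← tensorHom_id, ← tensorHom_id, tensorHom_comp_tensorHom, tensorHom_comp_tensorHom,
        sg_singleδ]
    have e2 : ((sg X).hom ⊗ₘ (sg (Y ⊗ Z)).hom) ≫ _ ◁ (singleδ Y Z).hom.f 0 =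
        ((sg X).hom ⊗ₘ ((sg Y).hom ⊗ₘ (sg Z).hom)) ≫ _ ◁ ιB _ _ := by
      rw [← id_tensorHom, ← id_tensorHom, tensorHom_comp_tensorHom, tensorHom_comp_tensorHom,
        sg_singleδ]
    rw [← Category.assoc, sg_singleδ, ← Category.assoc (sg _).hom, sg_map, Category.assoc,
      Category.assoc, ← Category.assoc (sg _).hom, sg_singleδ, Category.assoc, ιB_whiskerLeft,
      ← Category.assoc (ιB _ _), ιB_whiskerRight, Category.assoc,
      ← Category.assoc, e1, ← Category.assoc (_ ⊗ₘ _), e2, Category.assoc, ιB_associator,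
      Category.assoc, associator_naturality_assoc])
  oplax_left_unitality X := by
    have h : lamInv ((singleB C).obj X) = (singleB C).map (λ_ X).inv ≫ singleδ (𝟙_ C) X :=
      singleB_hom_ext (by
        change _ = (sg X).hom ≫ ((singleB C).map (λ_ X).inv).hom.f 0 ≫ (singleδ (𝟙_ C) X).hom.f 0
        rw [lamInv_zero, ← Category.assoc (sg X).hom (((singleB C).map _).hom.f _), sg_map,
          Category.assoc, sg_singleδ, tensorHom_def', leftUnitor_inv_naturality_assoc]
        simp only [Category.assoc])
    have h2 : singleδ (𝟙_ C) X ≫ (𝟙 (𝟙_ (ChB C)) ▷ (singleB C).obj X) = singleδ (𝟙_ C) X :=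
      (congrArg (fun t => singleδ (𝟙_ C) X ≫ t) (id_whiskerRight _ _)).trans (Category.comp_id _)
    exact h.trans (congrArg (fun t => (singleB C).map (λ_ X).inv ≫ t) h2.symm)
  oplax_right_unitality X := by
    have h : rhoInv ((singleB C).obj X) = (singleB C).map (ρ_ X).inv ≫ singleδ X (𝟙_ C) :=
      singleB_hom_ext (by
        change _ = (sg X).hom ≫ ((singleB C).map (ρ_ X).inv).hom.f 0 ≫ (singleδ X (𝟙_ C)).hom.f 0
        rw [rhoInv_zero, ← Category.assoc (sg X).hom (((singleB C).map _).hom.f _), sg_map,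
          Category.assoc, sg_singleδ, MonoidalCategory.tensorHom_def, rightUnitor_inv_naturality_assoc]
        simp only [Category.assoc])
    have h2 : singleδ X (𝟙_ C) ≫ ((singleB C).obj X ◁ 𝟙 (𝟙_ (ChB C))) = singleδ X (𝟙_ C) :=
      (congrArg (fun t => singleδ X (𝟙_ C) ≫ t) (whiskerLeft_id _ _)).trans (Category.comp_id _)
    exact h.trans (congrArg (fun t => (singleB C).map (ρ_ X).inv ≫ t) h2.symm)

noncomputable instance singleBMonoidal : (singleB C).Monoidal := by
  have : IsIso (Functor.OplaxMonoidal.η (singleB C)) := inferInstanceAs (IsIso (𝟙 _))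
  have (X Y : C) : IsIso (Functor.OplaxMonoidal.δ (singleB C) X Y) :=
    inferInstanceAs (IsIso (singleδ X Y))
  exact Functor.Monoidal.ofOplaxMonoidal _

end Single
section DbMonoidal

variable (C : Type u) [Category.{v} C] [Abelian C] [HasDerivedCategory.{v'} C]

/-- The embedding of an abelian category in its bounded derived category, as complexes
concentrated in degree zero. -/
noncomputable def degZero : C ⥤ DerivedCategory.Bounded C := singleB C ⋙ QB C

variable [MonoidalCategory C] [MonoidalPreadditive C] [BiexactTensor C]

/-- The tensor product of the bounded derived category: it is induced by the total tensor
product of bounded complexes. -/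
noncomputable instance dbMonoidal : MonoidalCategory (DerivedCategory.Bounded C) :=
  inferInstanceAs (MonoidalCategory (LocalizedMonoidal (QB C) (qisB C) (Iso.refl _)))

noncomputable instance QBMonoidal : (QB C).Monoidal :=
  inferInstanceAs (Localization.Monoidal.toMonoidalCategory (QB C) (qisB C) (Iso.refl _)).Monoidal

noncomputable instance degZeroMonoidal : (degZero C).Monoidal :=
  inferInstanceAs (singleB C ⋙ QB C).Monoidal

end DbMonoidal

section DerivedFunctor

variable {A : Type u} [Category.{v} A] [Abelian A] {B : Type u'} [Category.{v'} B] [Abelian B]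
  (F : A ⥤ B) [F.Additive] [PreservesFiniteLimits F] [PreservesFiniteColimits F]

universe w w'

variable [HasDerivedCategory.{w} A] [HasDerivedCategory.{w'} B]

/-- The functor on bounded derived categories induced by an exact functor, applied termwise
to complexes. -/
noncomputable def mapDb : DerivedCategory.Bounded A ⥤ DerivedCategory.Bounded B :=
  DerivedCategory.TStructure.t.bounded.lift (DerivedCategory.Bounded.ι ⋙ F.mapDerivedCategory)
    (fun X => by
      obtain ⟨K, hK, ⟨e⟩⟩ := exists_bounded_iso X
      obtain ⟨a, b, hab⟩ := hK.out
      exact DerivedCategory.TStructure.t.bounded.prop_of_iso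
        (F.mapDerivedCategory.mapIso e ≪≫ F.mapDerivedCategoryFactors.app K).symm
        (bounded_Q_obj _ ⟨a, b, fun i hi => F.map_isZero (hab i hi)⟩))

end DerivedFunctor

section Action

open MonoidalLeftAction

universe v₁ v₂ v₃ v₄ u₁ u₂ u₃ u₄

variable {C : Type u₁} [Category.{v₁} C] [MonoidalCategory C]
  {D : Type u₂} [Category.{v₂} D] [MonoidalCategory D]

open Functor.LaxMonoidal Functor.OplaxMonoidal

/-- The action of `C` on `N` obtained from an action of `D` on `N` and a monoidal functor
from `C` to `D`: an object `X` acts as `F.obj X`. -/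
abbrev restrictAction (F : C ⥤ D) [F.Monoidal] (N : Type u₃) [Category.{v₃} N]
    [MonoidalLeftAction D N] : MonoidalLeftAction C N where
  actionObj X d := F.obj X ⊙ₗ d
  actionHomLeft f d := F.map f ⊵ₗ d
  actionHomRight X _ _ f := F.obj X ⊴ₗ f
  actionHom f g := F.map f ⊙ₗₘ g
  actionAssocIso X Y d :=
    { hom := δ F X Y ⊵ₗ d ≫ (αₗ (F.obj X) (F.obj Y) d).hom
      inv := (αₗ (F.obj X) (F.obj Y) d).inv ≫ μ F X Y ⊵ₗ d
      hom_inv_id := by simp [← comp_actionHomLeft]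
      inv_hom_id := by simp [← comp_actionHomLeft_assoc] }
  actionUnitIso d :=
    { hom := η F ⊵ₗ d ≫ (λₗ d).hom
      inv := (λₗ d).inv ≫ ε F ⊵ₗ d
      hom_inv_id := by simp [← comp_actionHomLeft]
      inv_hom_id := by simp [← comp_actionHomLeft_assoc] }
  actionHom_def f g := actionHom_def _ _
  actionHomRight_id X d := actionHomRight_id _ _
  id_actionHomLeft X d := by simp
  actionHom_comp f₁ f₂ g₁ g₂ := by simp
  actionAssocIso_hom_naturality f g h := by
    dsimp only
    rw [Category.assoc, ← actionAssocIso_hom_naturality, ← actionHom_id, ← actionHom_id,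
      ← actionHom_comp_assoc, ← actionHom_comp_assoc, δ_natural, Category.id_comp,
      Category.comp_id]
  actionUnitIso_hom_naturality f := by
    dsimp only
    rw [Category.assoc, actionUnitIso_hom_naturality, ← action_exchange_assoc]
  whiskerLeft_actionHomLeft X Y Z f d := by
    simp only [Functor.Monoidal.map_whiskerLeft, comp_actionHomLeft, whiskerLeft_actionHomLeft,
      Category.assoc]
  whiskerRight_actionHomLeft Z f d := by
    simp only [Functor.Monoidal.map_whiskerRight, comp_actionHomLeft, whiskerRight_actionHomLeft,
      Category.assoc]
  associator_actionHom X Y Z d := by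
    have h := associator_actionHom (F.obj X) (F.obj Y) (F.obj Z) d
    have h1 : μ F X (Y ⊗ Z) ⊵ₗ d ≫ δ F X (Y ⊗ Z) ⊵ₗ d = 𝟙 _ := by
      rw [← comp_actionHomLeft, Functor.Monoidal.μ_δ, id_actionHomLeft]
    have h2 : F.obj X ⊴ₗ (μ F Y Z ⊵ₗ d) ≫ F.obj X ⊴ₗ (δ F Y Z ⊵ₗ d) = 𝟙 _ := by
      rw [← actionHomRight_comp, ← comp_actionHomLeft, Functor.Monoidal.μ_δ, id_actionHomLeft,
        actionHomRight_id]
    simp only [Functor.Monoidal.map_associator, comp_actionHomLeft, Category.assoc,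
      actionHomRight_comp]
    rw [reassoc_of% h1, whiskerLeft_actionHomLeft, Category.assoc, Category.assoc,
      Iso.inv_hom_id_assoc, reassoc_of% h2, h, whiskerRight_actionHomLeft, Category.assoc,
      Category.assoc, Iso.inv_hom_id_assoc]
  leftUnitor_actionHom X d := by
    simp only [Functor.Monoidal.map_leftUnitor, comp_actionHomLeft, Category.assoc,
      whiskerRight_actionHomLeft, leftUnitor_actionHom, Iso.inv_hom_id_assoc]
  rightUnitor_actionHom X d := by
    simp only [Functor.Monoidal.map_rightUnitor, comp_actionHomLeft, Category.assoc,
      whiskerLeft_actionHomLeft, rightUnitor_actionHom, actionHomRight_comp,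
      Iso.inv_hom_id_assoc]

end Action

section Statement

open MonoidalLeftAction

universe t v₁ v₂ v₃ v₄ u₁ u₂ u₃ u₄

/-- Let `C` act on `M` and `D` act on `N`, and let `F` be a monoidal functor from `C` to `D`.
This is the structure of a functor of `C`-module categories on a functor from `M` to `N`, where
`C` acts on `N` through `F`: natural isomorphisms between `F.obj X ⊙ₗ G.obj m` and
`G.obj (X ⊙ₗ m)` which are compatible with the associativity and unit constraints. -/
abbrev LeftLinearAlong {C : Type u₁} [Category.{v₁} C] [MonoidalCategory C]
    {D : Type u₂} [Category.{v₂} D] [MonoidalCategory D] (F : C ⥤ D) [F.Monoidal]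
    {M : Type u₃} [Category.{v₃} M] [MonoidalLeftAction C M]
    {N : Type u₄} [Category.{v₄} N] [MonoidalLeftAction D N] (G : M ⥤ N) :=
  @Functor.LeftLinear M N _ _ G C _ _ _ (restrictAction F N)

/-- A tensor category over a field `k`: a rigid `k`-linear abelian monoidal category with
`k`-bilinear tensor product which is locally finite (all spaces of morphisms are finite
dimensional and all objects have finite length) and in which the endomorphism algebra of the unit
object is `k`. -/
class IsTensorCategory (k : Type t) [Field k] (C : Type u₁) [Category.{v₁} C] [Abelian C]
    [Linear k C] [MonoidalCategory C] [MonoidalPreadditive C] [MonoidalLinear k C]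
    [RigidCategory C] : Prop where
  finite_hom (X Y : C) : Module.Finite k (X ⟶ Y)
  finite_length (X : C) : IsNoetherianObject X ∧ IsArtinianObject X
  end_unit : Nonempty (k ≃ₐ[k] End (𝟙_ C))

/-- The category `A` has only finitely many simple objects up to isomorphism. -/
def FinitelyManySimples (A : Type u₁) [Category.{v₁} A] [Abelian A] : Prop :=
  ∃ (n : ℕ) (S : Fin n → A), ∀ X : A, Simple X → ∃ j, Nonempty (X ≅ S j)

/-- The condition that an action of a monoidal abelian category on an abelian category
is biadditive and exact in each variable. -/
structure IsBiexactAction (C : Type u₁) [Category.{v₁} C] [Abelian C] [MonoidalCategory C]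
    (M : Type u₂) [Category.{v₂} M] [Abelian M] [MonoidalLeftAction C M] : Prop where
  additive_left (X : C) : (actionLeft M X).Additive
  additive_right (m : M) : (actionRight C m).Additive
  exact_left (X : C) : PreservesFiniteLimits (actionLeft M X) ∧
    PreservesFiniteColimits (actionLeft M X)
  exact_right (m : M) : PreservesFiniteLimits (actionRight C m) ∧
    PreservesFiniteColimits (actionRight C m)

/-- The condition that an action of a monoidal `k`-linear category on a `k`-linear category
is `k`-bilinear on morphisms. -/
structure IsBilinearAction (k : Type t) [Field k] (C : Type u₁) [Category.{v₁} C] [Preadditive C]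
    [Linear k C] [MonoidalCategory C] (M : Type u₂) [Category.{v₂} M] [Preadditive M] [Linear k M]
    [MonoidalLeftAction C M] : Prop where
  linear_left (X : C) : (actionLeft M X).Linear k
  linear_right (m : M) : (actionRight C m).Linear k

end Statement
end BoundedTensor

universe t v₁ v₂ v₃ v₄ u₁ u₂ u₃ u₄ w₁ w₂ w₃ w₄

open BoundedTensor DerivedCategory

/-! The degree-zero embeddings identify `A` and `B` with the hearts of the canonical t-structures,
so the task is to show that certain functors preserve hearts. Once they do, actions and module
functors restrict because the embeddings are fully faithful (`inducedAction`, `liftLeftLinear`).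

A faithful exact functor commutes with cohomology and reflects zero objects, so the amplitude of an
object of `Bounded A` can be read off after `mapDb iA`, and similarly for `B` (`isLE_mapDb_iff`,
`isGE_mapDb_iff`). There the action of `X` on `a` becomes `X ⊗ iA a`, which sits in degree zero.
Hence `C` acts on `A`, and exactness and bilinearity are inherited from the tensor product of `C`.

The crux is that `F` sends objects of `C` to complexes concentrated in degree zero, as soon as `A`
is nonzero (`mem_essImage_degZero_map`). The objects `F (iA a)` have amplitude in one fixed
interval: objects of `A` have finite length because those of `C` do, there are finitely many
simples, and short exact sequences give triangles (`exists_uniform_amplitude`). Tensoring with `F X`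
preserves this family, because `F X ⊗ F (iA a)` is `F (iA (X ⊙ₗ a))`. On the other hand, extreme
cohomological degrees add under the tensor product (`coh_tensor_top`, `coh_tensor_bot`): this is the
extreme case of the Künneth formula, together with the fact that nonzero objects of `D` have nonzero
tensor product, which follows from simplicity of the unit (`simple_unit`, `not_isZero_tensor`).
Cohomology of `F X` in a positive degree would push the top degree of the family beyond its maximum,
and negative degrees are excluded dually. A nonzero member of the family exists because `F ∘ iA`
agrees on `A` with `mapDb iB ∘ G`, which is faithful. If `A` is zero, so are both ideals.

Since `mapDb iB (G a) ≅ F (iA a)`, the functor `G` now maps heart to heart. A triangulated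
equivalence with this property also reflects the hearts, by orthogonality (`amplitude_of_map`), so
it induces `A ≌ B`. Exactness and bilinearity on `B` are transported along this equivalence. -/

namespace BoundedTensor

/-! ### Restriction and transport of module structures. -/

section ModuleCategories

open MonoidalLeftAction Functor.LaxLeftLinear Functor.OplaxLeftLinear

section Restriction

variable {C : Type u₁} [Category.{v₁} C] [MonoidalCategory C]

/-- A lax module functor whose structure morphisms are isomorphisms is a module functor. -/
@[reducible]
noncomputable def leftLinearOfLax {M : Type u₂} [Category.{v₂} M] {N : Type u₃} [Category.{v₃} N]
    [MonoidalLeftAction C M] [MonoidalLeftAction C N] (G : M ⥤ N) [G.LaxLeftLinear C]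
    [∀ (c : C) (m : M), IsIso (μₗ G c m)] : G.LeftLinear C where
  δₗ c m := inv (μₗ G c m)
  δₗ_naturality_left f m := by
    rw [IsIso.eq_inv_comp, ← μₗ_naturality_left_assoc, IsIso.hom_inv_id, Category.comp_id]
  δₗ_naturality_right c _ _ f := by
    rw [IsIso.eq_inv_comp, ← μₗ_naturality_right_assoc, IsIso.hom_inv_id, Category.comp_id]
  δₗ_associativity c c' m := by
    rw [← cancel_epi (μₗ G (c ⊗ c') m), IsIso.hom_inv_id_assoc, μₗ_associativity_assoc]
    simp
  δₗ_unitality_inv m := by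
    rw [← μₗ_unitality_inv, Category.assoc, IsIso.hom_inv_id, Category.comp_id]
  μₗ_comp_δₗ c m := by simp
  δₗ_comp_μₗ c m := by simp

section Induced

variable {A : Type u₂} [Category.{v₂} A] {M : Type u₃} [Category.{v₃} M]
  [MonoidalLeftAction C M] (j : A ⥤ M) [j.Full] [j.Faithful] (o : C → A → A)
  (e : ∀ X a, j.obj (o X a) ≅ X ⊙ₗ j.obj a)

/-- An action restricts along a fully faithful functor whose essential image it preserves. -/
@[reducible]
noncomputable def inducedAction : MonoidalLeftAction C A where
  actionObj := o
  actionHomLeft {X Y} f a := j.preimage ((e X a).hom ≫ f ⊵ₗ j.obj a ≫ (e Y a).inv)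
  actionHomRight X a b f := j.preimage ((e X a).hom ≫ X ⊴ₗ j.map f ≫ (e X b).inv)
  actionHom {X Y a b} f g := j.preimage ((e X a).hom ≫ (f ⊙ₗₘ j.map g) ≫ (e Y b).inv)
  actionAssocIso X Y a := j.preimageIso (e (X ⊗ Y) a ≪≫ αₗ X Y (j.obj a) ≪≫
    ⟨X ⊴ₗ (e Y a).inv, X ⊴ₗ (e Y a).hom, by simp, by simp⟩ ≪≫ (e X (o Y a)).symm)
  actionUnitIso a := j.preimageIso (e (𝟙_ C) a ≪≫ λₗ (j.obj a))
  actionHom_def f g := j.map_injective (by simp [actionHom_def])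
  actionHomRight_id X a := j.map_injective (by simp)
  id_actionHomLeft X a := j.map_injective (by simp)
  actionHom_comp f₁ f₂ g₁ g₂ := j.map_injective (by simp)
  actionAssocIso_hom_naturality {c₁ c₂ c₃ c₄ a b} f g h := j.map_injective (by
    -- Besides naturality of the constraint of `M`, the inner identification has to be moved past
    -- the action of `f`; `h2` does this by bifunctoriality.
    have h1 := actionAssocIso_hom_naturality f g (j.map h)
    have h2 : (f ⊙ₗₘ (g ⊙ₗₘ j.map h)) ≫ c₂ ⊴ₗ (e c₄ b).inv =
        c₁ ⊴ₗ (e c₃ a).inv ≫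
          (f ⊙ₗₘ ((e c₃ a).hom ≫ (g ⊙ₗₘ j.map h) ≫ (e c₄ b).inv)) := by
      rw [← id_actionHom, ← id_actionHom, ← actionHom_comp, ← actionHom_comp]
      simp
    simp [reassoc_of% h1, reassoc_of% h2])
  actionUnitIso_hom_naturality f := j.map_injective (by simp)
  whiskerLeft_actionHomLeft X Y Z f a := j.map_injective (by simp)
  whiskerRight_actionHomLeft {X Y} Z f a := j.map_injective (by
    have h1 : X ⊴ₗ (e Z a).inv ≫ f ⊵ₗ j.obj (o Z a) ≫ Y ⊴ₗ (e Z a).hom =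
        f ⊵ₗ (Z ⊙ₗ j.obj a) := by
      rw [← action_exchange, ← actionHomRight_comp_assoc, Iso.inv_hom_id, actionHomRight_id,
        Category.id_comp]
    simp [reassoc_of% h1])
  associator_actionHom X Y Z a := j.map_injective (by
    have h1 := actionAssocIso_hom_naturality (𝟙 X) (𝟙 Y) (e Z a).inv
    have h2 := associator_actionHom X Y Z (j.obj a)
    simp only [id_tensorHom, whiskerLeft_id, id_actionHom] at h1
    simp [reassoc_of% h2])
  leftUnitor_actionHom X a := j.map_injective (by simp)
  rightUnitor_actionHom X a := j.map_injective (by simp)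

/-- The functor along which an action is restricted is a module functor. -/
@[reducible]
noncomputable def inducedActionLeftLinear :
    letI := inducedAction j o e
    j.LeftLinear C :=
  letI := inducedAction j o e
  { μₗ X a := (e X a).inv
    δₗ X a := (e X a).hom
    μₗ_naturality_left f a := by simp [actionHomLeft]
    μₗ_naturality_right X a b f := by simp [actionHomRight]
    μₗ_associativity X Y a := by
      simp [actionAssocIso]
      rfl
    μₗ_unitality a := by simp [actionUnitIso]
    δₗ_naturality_left f a := by simp [actionHomLeft]
    δₗ_naturality_right X a b f := by simp [actionHomRight]
    δₗ_associativity X Y a := by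
      have h : X ⊴ₗ (e Y a).inv ≫ X ⊴ₗ (e Y a).hom = 𝟙 _ := actionHomRight_inv_hom X (e Y a)
      -- `o Y a` and `Y ⊙ₗ a` agree only by unfolding the induced action, so the cancellation is
      -- stated with both spellings.
      have h' : (e X (o Y a)).inv ≫ (e X (Y ⊙ₗ a)).hom = 𝟙 _ := (e X (o Y a)).inv_hom_id
      simp only [actionAssocIso, Functor.preimageIso_hom, Functor.map_preimage, Iso.trans_hom,
        Iso.symm_hom, Category.assoc, reassoc_of% h', h]
      simp
    δₗ_unitality_inv a := by simp [actionUnitIso]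
    μₗ_comp_δₗ X a := by simp
    δₗ_comp_μₗ X a := by simp }

end Induced

end Restriction

section Lift

variable {A : Type u₁} [Category.{v₁} A] {B : Type u₂} [Category.{v₂} B]
  {M : Type u₃} [Category.{v₃} M] {N : Type u₄} [Category.{v₄} N]
  {C : Type w₁} [Category.{w₂} C] [MonoidalCategory C]
  [MonoidalLeftAction C A] [MonoidalLeftAction C B] [MonoidalLeftAction C M]
  [MonoidalLeftAction C N] (j : A ⥤ M) [j.LeftLinear C] (j' : B ⥤ N) [j'.LeftLinear C]
  [j'.Full] [j'.Faithful] (G : M ⥤ N) [G.LeftLinear C] (G₀ : A ⥤ B) (φ : G₀ ⋙ j' ≅ j ⋙ G)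

/-- A functor which is induced on full subcategories by a module functor is a module functor. -/
@[reducible]
noncomputable def liftLeftLinear : G₀.LeftLinear C := by
  -- The formula is forced by requiring `φ` to be compatible with the module structures of `G₀ ⋙ j'`
  -- and `j ⋙ G`.
  let m (c : C) (a : A) : c ⊙ₗ G₀.obj a ⟶ G₀.obj (c ⊙ₗ a) :=
    j'.preimage (δₗ j' c (G₀.obj a) ≫ c ⊴ₗ φ.hom.app a ≫ μₗ G c (j.obj a) ≫
      G.map (μₗ j c a) ≫ φ.inv.app (c ⊙ₗ a))
  have hm (c : C) (a : A) : j'.map (m c a) = δₗ j' c (G₀.obj a) ≫ c ⊴ₗ φ.hom.app a ≫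
      μₗ G c (j.obj a) ≫ G.map (μₗ j c a) ≫ φ.inv.app (c ⊙ₗ a) := j'.map_preimage _
  have n1 {a b : A} (f : a ⟶ b) : φ.inv.app a ≫ j'.map (G₀.map f) =
    G.map (j.map f) ≫ φ.inv.app b := (φ.inv.naturality f).symm
  have n2 {a b : A} (f : a ⟶ b) : j'.map (G₀.map f) ≫ φ.hom.app b =
    φ.hom.app a ≫ G.map (j.map f) := φ.hom.naturality f
  letI : G₀.LaxLeftLinear C :=
    { μₗ := m
      μₗ_naturality_left {c c'} f a := j'.map_injective (by
        simp only [Functor.map_comp, hm, Category.assoc, n1]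
        rw [δₗ_naturality_left_assoc, ← Functor.map_comp_assoc, ← μₗ_naturality_left,
          Functor.map_comp_assoc, ← μₗ_naturality_left_assoc, ← action_exchange_assoc]
        rfl)
      μₗ_naturality_right c a b f := j'.map_injective (by
        simp only [Functor.map_comp, hm, Category.assoc, n1]
        rw [δₗ_naturality_right_assoc, ← actionHomRight_comp_assoc, n2, actionHomRight_comp_assoc,
          μₗ_naturality_right_assoc, ← Functor.map_comp_assoc, μₗ_naturality_right,
          Functor.map_comp_assoc])
      μₗ_associativity c c' a := j'.map_injective (by
        simp only [Functor.map_comp, hm, Category.assoc, n1]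
        rw [← Functor.map_comp_assoc, μₗ_associativity, Functor.map_comp_assoc,
          μₗ_associativity_assoc, Functor.map_comp_assoc, δₗ_naturality_right_assoc, hm]
        simp only [actionHomRight_comp, Category.assoc]
        have h := (μₗ_naturality_right G c (μₗ j c' a)).symm
        have h' : c ⊴ₗ φ.inv.app (c' ⊙ₗ a) ≫ c ⊴ₗ φ.hom.app (c' ⊙ₗ a) = 𝟙 _ := by
          rw [← actionHomRight_comp, Iso.inv_hom_id_app, actionHomRight_id]
        rw [← δₗ_associativity_assoc, reassoc_of% h, reassoc_of% h']
        simp)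
      μₗ_unitality a := j'.map_injective (by
        simp only [Functor.map_comp, hm, Category.assoc, n1]
        rw [← Functor.map_comp_assoc, ← μₗ_unitality, ← μₗ_unitality_assoc,
          ← reassoc_of% actionUnitIso_hom_naturality (C := C) (φ.hom.app a)]
        simp) }
  -- All five factors of the image under `j'` are isomorphisms, so the lax structure is a strong
  -- one.
  have (c : C) (a : A) : IsIso (μₗ G₀ c a) := by
    have : IsIso (j'.map (m c a)) := by rw [hm]; infer_instance
    exact isIso_of_fully_faithful j' (m c a)
  exact leftLinearOfLax G₀

end Lift

section Along

open Functor.LaxMonoidal Functor.OplaxMonoidal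

variable {C : Type u₁} [Category.{v₁} C] [MonoidalCategory C]
  {D : Type u₂} [Category.{v₂} D] [MonoidalCategory D] (φ : C ⥤ D) [φ.Monoidal]

/-- An equality of structures, so that the action in the type of a module functor can be rewritten
along it. The actions on objects and morphisms agree by definition; only the associativity and unit
constraints differ, by functoriality of the action on a composite of `δ`'s or `η`'s. -/
lemma restrictAction_comp {E : Type u₃} [Category.{v₃} E] [MonoidalCategory E]
    (F : D ⥤ E) [F.Monoidal] (N : Type u₄) [Category.{v₄} N] [MonoidalLeftAction E N] :
    (letI := restrictAction F N; restrictAction φ N) = restrictAction (φ ⋙ F) N := by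
  unfold restrictAction
  congr 2
  · funext X Y d
    ext
    simp only [Functor.OplaxMonoidal.comp_δ, comp_actionHomLeft, Category.assoc]
    rfl
  · funext d
    ext
    simp only [Functor.OplaxMonoidal.comp_η, comp_actionHomLeft, Category.assoc]
    rfl

/-- A module functor is a module functor for the restricted actions. -/
@[reducible]
noncomputable def restrictLeftLinear {M : Type u₃} [Category.{v₃} M] [MonoidalLeftAction D M]
    {N : Type u₄} [Category.{v₄} N] [MonoidalLeftAction D N] (G : M ⥤ N) [G.LeftLinear D] :
    @Functor.LeftLinear M N _ _ G C _ _ (restrictAction φ M) (restrictAction φ N) :=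
  letI := restrictAction φ M
  letI := restrictAction φ N
  letI : G.LaxLeftLinear C :=
    { μₗ X m := μₗ G (φ.obj X) m
      μₗ_naturality_left f m := μₗ_naturality_left G (φ.map f) m
      μₗ_naturality_right X _ _ f := μₗ_naturality_right G (φ.obj X) f
      μₗ_associativity X Y m := by
        -- The restricted associativity constraint starts with `δ φ X Y`; naturality in the acting
        -- object moves it across `μₗ G` and leaves the identity over `D`.
        have h := μₗ_associativity G (φ.obj X) (φ.obj Y) m
        have h' := μₗ_naturality_left G (δ φ X Y) m
        refine (whisker_eq _ (Functor.map_comp G _ _)).trans ?_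
        rw [← reassoc_of% h', h, ← Category.assoc]
        rfl
      μₗ_unitality m := by
        have h := μₗ_unitality G (C := D) m
        have h' := μₗ_naturality_left G (η φ) m
        refine Eq.symm ((whisker_eq _ (Functor.map_comp G _ _)).trans ?_)
        rw [← reassoc_of% h', ← h]
        rfl }
  haveI (X : C) (m : M) : IsIso (μₗ G X m) := inferInstanceAs (IsIso (μₗ G (φ.obj X) m))
  leftLinearOfLax G

end Along

end ModuleCategories
-- t-exactness of triangulated functors that preserve the heart.
section TExact

open Pretriangulated Triangulated ZeroObject

variable {T : Type u₁} [Category.{v₁} T] [Preadditive T] [HasZeroObject T] [HasShift T ℤ]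
  [∀ n : ℤ, (shiftFunctor T n).Additive] [Pretriangulated T] [IsTriangulated T]
  {T' : Type u₂} [Category.{v₂} T'] [Preadditive T'] [HasZeroObject T'] [HasShift T' ℤ]
  [∀ n : ℤ, (shiftFunctor T' n).Additive] [Pretriangulated T']
  (t : TStructure T) (t' : TStructure T') (Φ : T ⥤ T') [Φ.CommShift ℤ] [Φ.IsTriangulated]

/-- A triangulated functor which maps the heart of a t-structure to the heart of a t-structure is
t-exact on bounded objects. -/
lemma amplitude_map
    (h : ∀ X, t.IsGE X 0 → t.IsLE X 0 → t'.IsGE (Φ.obj X) 0 ∧ t'.IsLE (Φ.obj X) 0)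
    (X : T) (a b : ℤ) (ha : t.IsGE X a) (hb : t.IsLE X b) :
    t'.IsGE (Φ.obj X) a ∧ t'.IsLE (Φ.obj X) b := by
  have hshift (X : T) (a : ℤ) (ha : t.IsGE X a) (ha' : t.IsLE X a) :
      t'.IsGE (Φ.obj X) a ∧ t'.IsLE (Φ.obj X) a := by
    obtain ⟨h1, h2⟩ := h (X⟦a⟧) (t.isGE_shift X a a 0) (t.isLE_shift X a a 0)
    have e : Φ.obj (X⟦a⟧) ≅ (Φ.obj X)⟦a⟧ := (Φ.commShiftIso a).app X
    have := t'.isGE_of_iso e 0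
    have := t'.isLE_of_iso e 0
    exact ⟨t'.isGE_of_shift (Φ.obj X) a a 0, t'.isLE_of_shift (Φ.obj X) a a 0⟩
  -- Induction on the number `N` of degrees in the interval; `N = 0` is an empty interval, that is,
  -- a zero object.
  suffices H : ∀ (N : ℕ) (X : T) (a : ℤ), t.IsGE X a → t.IsLE X (a + N - 1) →
      t'.IsGE (Φ.obj X) a ∧ t'.IsLE (Φ.obj X) (a + N - 1) by
    by_cases hab : a ≤ b + 1
    · obtain ⟨N, hN⟩ := Int.le.dest hab
      obtain rfl : b = a + N - 1 := by omega
      exact H N X a ha hb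
    · have := t.isZero X b a (by omega)
      exact ⟨t'.isGE_of_isZero (Φ.map_isZero this) _, t'.isLE_of_isZero (Φ.map_isZero this) _⟩
  intro N
  induction N with
  | zero =>
    intro X a _ _
    have := Φ.map_isZero (t.isZero X (a + (0 : ℕ) - 1) a (by simp))
    exact ⟨t'.isGE_of_isZero this _, t'.isLE_of_isZero this _⟩
  | succ N ih =>
    intro X a _ _
    -- Split off the lowest degree: `truncLT (a + 1)` is concentrated in degree `a`, and `truncGE (a
    -- + 1)` has one degree fewer.
    obtain ⟨h1, h1'⟩ := hshift ((t.truncLT (a + 1)).obj X) a inferInstance inferInstance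
    obtain ⟨h2, h2'⟩ := ih ((t.truncGE (a + 1)).obj X) (a + 1) inferInstance (by
      have : t.IsLE ((t.truncGE (a + 1)).obj X) (a + (N + 1 : ℕ) - 1) := inferInstance
      exact t.isLE_of_le _ (a + (N + 1 : ℕ) - 1) _ (by push_cast; omega))
    have hT := Φ.map_distinguished _ (t.triangleLTGE_distinguished (a + 1) X)
    exact ⟨t'.isGE₂ _ hT a h1 (t'.isGE_of_ge (Φ.obj ((t.truncGE (a + 1)).obj X)) a (a + 1)),
      t'.isLE₂ _ hT _
        (t'.isLE_of_le (Φ.obj ((t.truncLT (a + 1)).obj X)) a _ (by push_cast; omega))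
        (t'.isLE_of_le (Φ.obj ((t.truncGE (a + 1)).obj X)) (a + 1 + N - 1) _
          (by push_cast; omega))⟩

/-- A t-exact equivalence of bounded t-structures reflects the heart. -/
lemma amplitude_of_map [Φ.Full] [Φ.Faithful]
    (h : ∀ X, t.IsGE X 0 → t.IsLE X 0 → t'.IsGE (Φ.obj X) 0 ∧ t'.IsLE (Φ.obj X) 0)
    (hb : ∀ X, ∃ a b, t.IsGE X a ∧ t.IsLE X b)
    (X : T) (a b : ℤ) (ha : t'.IsGE (Φ.obj X) a) (hb' : t'.IsLE (Φ.obj X) b) :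
    t.IsGE X a ∧ t.IsLE X b := by
  constructor
  -- Being `≥ a` means receiving no nonzero morphism from objects `≤ a - 1`. These are sent by `Φ`
  -- to objects `≤ a - 1`, so the image of such a morphism vanishes, and `Φ` is faithful.
  · rw [t.isGE_iff_orthogonal (a - 1) a (by omega)]
    intro Y f hY
    -- `amplitude_map` needs bounds on both sides; the value of `c` plays no role.
    obtain ⟨c, -, hc, -⟩ := hb Y
    obtain ⟨-, hY'⟩ := amplitude_map t t' Φ h Y c (a - 1) hc hY
    exact Φ.map_injective (by rw [Φ.map_zero]; exact t'.zero (Φ.map f) (a - 1) a)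
  · rw [t.isLE_iff_orthogonal b (b + 1) rfl]
    intro Y f hY
    obtain ⟨-, c, -, hc⟩ := hb Y
    obtain ⟨hY', -⟩ := amplitude_map t t' Φ h Y (b + 1) c hY hc
    exact Φ.map_injective (by rw [Φ.map_zero]; exact t'.zero (Φ.map f) b (b + 1))

end TExact

/-! ### The canonical t-structure on the bounded derived category and its heart. -/

section Heart

open Pretriangulated Triangulated DerivedCategory.TStructure

variable (C : Type u₁) [Category.{v₁} C] [Abelian C] [HasDerivedCategory.{w₁} C]

/-- The canonical t-structure on the bounded derived category. -/
noncomputable abbrev tB : TStructure (Bounded C) := (TStructure.t (C := C)).onBounded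

variable {C}

lemma tB_isLE_iff (X : Bounded C) (n : ℤ) : (tB C).IsLE X n ↔ X.obj.IsLE n :=
  ObjectProperty.tStructure_isLE_iff _ _ _ _

lemma tB_isGE_iff (X : Bounded C) (n : ℤ) : (tB C).IsGE X n ↔ X.obj.IsGE n :=
  ObjectProperty.tStructure_isGE_iff _ _ _ _

lemma tB_bounded (X : Bounded C) : ∃ a b, (tB C).IsGE X a ∧ (tB C).IsLE X b := by
  obtain ⟨⟨a, ha⟩, ⟨b, hb⟩⟩ := X.property
  exact ⟨a, b, (tB_isGE_iff X a).2 ha, (tB_isLE_iff X b).2 hb⟩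

/-- Without cohomology, the object is both `≤ -1` and `≥ 0`. -/
lemma isZero_of_homology (X : DerivedCategory C)
    (h : ∀ n, IsZero ((homologyFunctor C n).obj X)) : IsZero X := by
  have h1 : X.IsLE (-1) := (isLE_iff X _).2 (fun i _ => h i)
  have h2 : X.IsGE 0 := (isGE_iff X _).2 (fun i _ => h i)
  exact TStructure.t.isZero X (-1) 0

variable (C) in
/-- The degree zero embedding in the derived category factors through the bounded derived
category. -/
noncomputable def degZeroCompι : degZero C ⋙ Bounded.ι ≅ singleFunctor C 0 :=
  (singleFunctorIsoCompQ C 0).symm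

instance : (degZero C).Faithful := Functor.Faithful.of_comp_iso (degZeroCompι C)

instance : (degZero C).Full := Functor.Full.of_comp_faithful_iso (degZeroCompι C)

instance : (degZero C).Additive :=
  have : (degZero C ⋙ Bounded.ι).Additive := Functor.additive_of_iso (degZeroCompι C).symm
  Functor.additive_of_comp_faithful _ (Bounded.ι (C := C))

lemma linear_of_comp_faithful {k : Type t} [Ring k] {A : Type u₂} [Category.{v₂} A]
    [Preadditive A] [Linear k A] {B : Type u₃} [Category.{v₃} B] [Preadditive B] [Linear k B]
    {D : Type u₄} [Category.{v₄} D] [Preadditive D] [Linear k D] (F : A ⥤ B) (G : B ⥤ D)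
    [G.Linear k] [G.Faithful] [(F ⋙ G).Linear k] : F.Linear k where
  map_smul f r := G.map_injective (by
    rw [Functor.Linear.map_smul (F := G)]
    exact Functor.Linear.map_smul (F := F ⋙ G) f r)

instance (k : Type t) [Ring k] [Linear k C] : (degZero C).Linear k :=
  have : (degZero C ⋙ Bounded.ι).Linear k := Functor.linear_of_iso k (degZeroCompι C).symm
  linear_of_comp_faithful _ (Bounded.ι (C := C))

instance (X : C) : (tB C).IsLE ((degZero C).obj X) 0 := by
  rw [tB_isLE_iff]
  exact TStructure.t.isLE_of_iso ((degZeroCompι C).symm.app X) 0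

instance (X : C) : (tB C).IsGE ((degZero C).obj X) 0 := by
  rw [tB_isGE_iff]
  exact TStructure.t.isGE_of_iso ((degZeroCompι C).symm.app X) 0

lemma mem_essImage_degZero (X : Bounded C) (h : (tB C).IsGE X 0) (h' : (tB C).IsLE X 0) :
    (degZero C).essImage X := by
  rw [tB_isLE_iff] at h'
  rw [tB_isGE_iff] at h
  obtain ⟨Y, ⟨e⟩⟩ := exists_iso_singleFunctor_obj_of_isGE_of_isLE X.obj 0
  exact ⟨Y, ⟨Bounded.ι.preimageIso ((degZeroCompι C).app Y ≪≫ e.symm)⟩⟩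

/-- The connecting morphism is the one of the full derived category, corrected by the isomorphism
that makes the inclusion commute with the shift; being distinguished can be tested after that
inclusion. These triangles turn extensions in an abelian category into amplitude bounds. -/
lemma degZero_distinguished {S : ShortComplex C} (hS : S.ShortExact) :
    ∃ δ, Triangle.mk ((degZero C).map S.f) ((degZero C).map S.g) δ ∈ distTriang (Bounded C) := by
  let e := (Bounded.ι (C := C)).commShiftIso (1 : ℤ)
  let δ : (degZero C).obj S.X₃ ⟶ ((degZero C).obj S.X₁)⟦(1 : ℤ)⟧ :=
    ObjectProperty.homMk (hS.singleδ ≫ e.inv.app ((degZero C).obj S.X₁))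
  refine ⟨δ, ?_⟩
  rw [← Functor.map_distinguished_iff (Bounded.ι (C := C))]
  refine isomorphic_distinguished _ hS.singleTriangle_distinguished _ ?_
  refine Triangle.isoMk _ _ (Iso.refl _) (Iso.refl _) (Iso.refl _) ?_ ?_ ?_
  · exact (Category.comp_id _).trans (Category.id_comp _).symm
  · exact (Category.comp_id _).trans (Category.id_comp _).symm
  · have h : e.inv.app ((degZero C).obj S.X₁) ≫ e.hom.app _ = 𝟙 _ := e.inv_hom_id_app _
    have h' : (hS.singleδ ≫ e.inv.app ((degZero C).obj S.X₁)) ≫ e.hom.app _ = hS.singleδ :=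
      (Category.assoc _ _ _).trans ((whisker_eq hS.singleδ h).trans (Category.comp_id _))
    refine Eq.trans (whisker_eq _ (CategoryTheory.Functor.map_id _ _)) ((Category.comp_id _).trans
      (Eq.trans ?_ (Category.id_comp _).symm))
    exact h'

end Heart

/-! ### Derived functors of faithful exact functors. -/

section MapDb

variable {A : Type u₁} [Category.{v₁} A] [Abelian A] [HasDerivedCategory.{w₁} A]
  {B : Type u₂} [Category.{v₂} B] [Abelian B] [HasDerivedCategory.{w₂} B]
  (F : A ⥤ B) [F.Additive] [PreservesFiniteLimits F] [PreservesFiniteColimits F]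

instance : (mapDb F).Additive := by
  unfold mapDb
  infer_instance

/-- An exact functor commutes with the degree zero embeddings. -/
noncomputable def degZeroCompMapDb : degZero A ⋙ mapDb F ≅ F ⋙ degZero B :=
  NatIso.ofComponents (fun X => TStructure.t.bounded.isoMk
      ((F.mapDerivedCategorySingleFunctor 0).app X))
    (fun f => ObjectProperty.hom_ext _ ((F.mapDerivedCategorySingleFunctor 0).hom.naturality f))

/-- An exact functor commutes with cohomology, and a faithful additive functor reflects zero
objects. Hence amplitudes can be tested after applying the derived functor of an inclusion. -/
lemma isZero_homology_mapDerivedCategory_iff [F.Faithful] (X : DerivedCategory A) (n : ℤ) :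
    IsZero ((homologyFunctor B n).obj (F.mapDerivedCategory.obj X)) ↔
      IsZero ((homologyFunctor A n).obj X) := by
  obtain ⟨K, ⟨e⟩⟩ : ∃ K, Nonempty (X ≅ Q.obj K) := ⟨_, ⟨(Q.objObjPreimageIso X).symm⟩⟩
  have e1 : (homologyFunctor B n).obj (F.mapDerivedCategory.obj X) ≅
      F.obj (K.homology n) :=
    (homologyFunctor B n).mapIso (F.mapDerivedCategory.mapIso e ≪≫
      F.mapDerivedCategoryFactors.app K) ≪≫ (homologyFunctorFactors B n).app _ ≪≫
      (K.sc n).mapHomologyIso F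
  have e2 : (homologyFunctor A n).obj X ≅ K.homology n :=
    (homologyFunctor A n).mapIso e ≪≫ (homologyFunctorFactors A n).app K
  rw [e1.isZero_iff, e2.isZero_iff]
  refine ⟨fun h => ?_, fun h => F.map_isZero h⟩
  rw [IsZero.iff_id_eq_zero] at h ⊢
  exact F.map_injective (by rw [F.map_id, h, F.map_zero])

lemma isLE_mapDb_iff [F.Faithful] (X : Bounded A) (n : ℤ) :
    (tB B).IsLE ((mapDb F).obj X) n ↔ (tB A).IsLE X n := by
  rw [tB_isLE_iff, tB_isLE_iff, isLE_iff, isLE_iff]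
  exact forall₂_congr (fun i _ => isZero_homology_mapDerivedCategory_iff F X.obj i)

lemma isGE_mapDb_iff [F.Faithful] (X : Bounded A) (n : ℤ) :
    (tB B).IsGE ((mapDb F).obj X) n ↔ (tB A).IsGE X n := by
  rw [tB_isGE_iff, tB_isGE_iff, isGE_iff, isGE_iff]
  exact forall₂_congr (fun i _ => isZero_homology_mapDerivedCategory_iff F X.obj i)

end MapDb

/-! ### Extreme cohomology of a tensor product of complexes. -/

section Kunneth

open HomologicalComplex

variable {C : Type u₁} [Category.{v₁} C] [Abelian C]

/-- The bounded complex with one object in one degree. -/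
noncomputable def singleChB (n : ℤ) (X : C) : ChB C :=
  ⟨(single C (ComplexShape.up ℤ) n).obj X, n, n, fun i hi =>
    isZero_single_obj_X _ _ _ _ (fun h => hi (by simp [h]))⟩

lemma isZero_singleChB (n i : ℤ) (X : C) (hi : i ≠ n) : IsZero ((singleChB n X).obj.X i) :=
  isZero_single_obj_X _ _ _ _ hi

/-- A complex maps to the opcycles in any degree. -/
noncomputable def toSingleOpcycles (K : ChB C) (n : ℤ) : K ⟶ singleChB n (K.obj.opcycles n) :=
  ObjectProperty.homMk (mkHomToSingle (K.obj.pOpcycles n) (fun i _ => K.obj.d_pOpcycles i n))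

instance (K : ChB C) (n : ℤ) : Epi ((toSingleOpcycles K n).hom.f n) := by
  change Epi ((mkHomToSingle (K.obj.pOpcycles n) (fun i _ => K.obj.d_pOpcycles i n)).f n)
  rw [mkHomToSingle_f]
  exact epi_comp' inferInstance
    (inferInstanceAs (Epi (singleObjXSelf (ComplexShape.up ℤ) n (K.obj.opcycles n)).symm.hom))

/-- The cycles in any degree map to a complex. -/
noncomputable def fromSingleCycles (K : ChB C) (n : ℤ) : singleChB n (K.obj.cycles n) ⟶ K :=
  ObjectProperty.homMk (mkHomFromSingle (K.obj.iCycles n) (fun i _ => K.obj.iCycles_d n i))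

instance (K : ChB C) (n : ℤ) : Mono ((fromSingleCycles K n).hom.f n) := by
  change Mono ((mkHomFromSingle (K.obj.iCycles n) (fun i _ => K.obj.iCycles_d n i)).f n)
  rw [mkHomFromSingle_f]
  exact mono_comp' (inferInstanceAs (Mono
    (singleObjXSelf (ComplexShape.up ℤ) n (K.obj.cycles n)).hom)) inferInstance

variable [MonoidalCategory C] [MonoidalPreadditive C]

lemma isZero_tensor_X (K L : ChB C) (n : ℤ)
    (h : ∀ i j, i + j = n → IsZero (K.obj.X i) ∨ IsZero (L.obj.X j)) :
    IsZero ((K ⊗ L).obj.X n) := by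
  rw [IsZero.iff_id_eq_zero]
  refine GradedObject.Monoidal.tensorObj_ext (X₁ := K.obj.X) (X₂ := L.obj.X) _ _
    (fun i j hij => IsZero.eq_of_src ?_ _ _)
  obtain h | h := h i j hij
  · exact isZero_tensor_left h _
  · exact isZero_tensor_right _ h

/-- The inclusion of a summand of a tensor product of bounded complexes. -/
noncomputable def ιBd (K L : ChB C) (i j n : ℤ) (h : i + j = n) :
    K.obj.X i ⊗ L.obj.X j ⟶ (K ⊗ L).obj.X n :=
  GradedObject.Monoidal.ιTensorObj K.obj.X L.obj.X i j n h

lemma ιBd_tensorHom {K K' L L' : ChB C} (f : K ⟶ K') (g : L ⟶ L') (i j n : ℤ) (h : i + j = n) :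
    ιBd K L i j n h ≫ (f ⊗ₘ g).hom.f n = (f.hom.f i ⊗ₘ g.hom.f j) ≫ ιBd K' L' i j n h :=
  GradedObject.Monoidal.ι_tensorHom f.hom.f g.hom.f i j n h

instance (K L : ChB C) (i j n : ℤ) (h : i + j = n) : Mono (ιBd K L i j n h) := by
  have : IsSplitMono (ιBd K L i j n h) := ⟨⟨⟨_, inj_cofanProj_self
    (GradedObject.isColimitCofanMapObj
      (((GradedObject.mapBifunctor (curriedTensor C) ℤ ℤ).obj K.obj.X).obj L.obj.X)
    (fun (x : ℤ × ℤ) => x.1 + x.2) n) ⟨⟨i, j⟩, h⟩⟩⟩⟩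
  infer_instance

instance (m n l : ℤ) (X : C) (L : ChB C) (h : m + n = l) :
    IsIso (ιBd (singleChB m X) L m n l h) :=
  isIso_ι_left _ _ _ _ _ _ (fun i hi => isZero_singleChB m i X hi)

/-- The top degree of the Künneth formula, in the one direction needed. The product of the
projections to the top opcycles is an epimorphism in degree `b + c`. If the cohomology of `K ⊗ L`
vanishes there, the incoming differential is an epimorphism too; but its composite with the
projection factors through a zero term, so the target vanishes. -/
lemma isZero_tensor_opcycles [BiexactTensor C] (K L : ChB C) (b c : ℤ)
    (hK : ∀ i, b < i → IsZero (K.obj.X i)) (hL : ∀ i, c < i → IsZero (L.obj.X i))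
    (h : IsZero ((K ⊗ L).obj.homology (b + c))) :
    IsZero (K.obj.opcycles b ⊗ L.obj.opcycles c) := by
  let f := toSingleOpcycles K b ⊗ₘ toSingleOpcycles L c
  have hepi : Epi (f.hom.f (b + c)) := by
    have h1 : Epi ((toSingleOpcycles K b).hom.f b ⊗ₘ (toSingleOpcycles L c).hom.f c) := by
      have := BiexactTensor.left (C := C)
      have := BiexactTensor.right (C := C)
      have h2 : Epi ((toSingleOpcycles K b).hom.f b ▷ L.obj.X c) :=
        (tensorRight (L.obj.X c)).map_epi _
      have h3 : Epi ((singleChB b (K.obj.opcycles b)).obj.X b ◁ (toSingleOpcycles L c).hom.f c) :=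
        (tensorLeft _).map_epi _
      rw [MonoidalCategory.tensorHom_def]
      infer_instance
    have h2 := ιBd_tensorHom (toSingleOpcycles K b) (toSingleOpcycles L c) b c (b + c) rfl
    have h3 : Epi (ιBd K L b c (b + c) rfl ≫ f.hom.f (b + c)) := by
      rw [h2]
      exact epi_comp _ (ιBd _ _ b c (b + c) rfl)
    -- The map is already an epimorphism on the summand of bidegree `(b, c)`.
    exact epi_of_epi (ιBd K L b c (b + c) rfl) _
  have hz : IsZero ((K ⊗ L).obj.X (b + c + 1)) := isZero_tensor_X _ _ _ (fun i j hij => by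
    by_cases hi : b < i
    · exact Or.inl (hK i hi)
    · exact Or.inr (hL j (by omega)))
  have hz' : IsZero ((singleChB b (K.obj.opcycles b) ⊗ singleChB c (L.obj.opcycles c)).obj.X
      (b + c - 1)) := isZero_tensor_X _ _ _ (fun i j hij => by
    by_cases hi : i = b
    · exact Or.inr (isZero_singleChB _ _ _ (by omega))
    · exact Or.inl (isZero_singleChB _ _ _ hi))
  -- Exactness in degree `b + c`, followed by a zero term.
  have hd : Epi ((K ⊗ L).obj.d (b + c - 1) (b + c)) := by
    have := (exactAt_iff_isZero_homology _ _).2 h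
    rw [exactAt_iff' _ (b + c - 1) (b + c) (b + c + 1) (by simp) (by simp)] at this
    exact this.epi_f (hz.eq_of_tgt _ _)
  have h0 : f.hom.f (b + c) = 0 := by
    rw [← cancel_epi ((K ⊗ L).obj.d (b + c - 1) (b + c)), comp_zero, ← f.hom.comm,
      hz'.eq_of_tgt (f.hom.f (b + c - 1)) 0, zero_comp]
  have h1 := IsZero.of_epi_eq_zero _ h0
  refine h1.of_iso ((?_ : _ ≅ _) ≪≫ asIso (ιBd _ _ b c (b + c) rfl))
  exact (singleObjXSelf (ComplexShape.up ℤ) b _).symm ⊗ᵢ (singleObjXSelf (ComplexShape.up ℤ) c _).symm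

/-- Dual to the top degree: the product of the bottom cycles embeds in degree `b + c` of `K ⊗ L`,
where vanishing cohomology makes the outgoing differential a monomorphism, while the embedding
followed by that differential is zero. -/
lemma isZero_tensor_cycles [BiexactTensor C] (K L : ChB C) (b c : ℤ)
    (hK : ∀ i, i < b → IsZero (K.obj.X i)) (hL : ∀ i, i < c → IsZero (L.obj.X i))
    (h : IsZero ((K ⊗ L).obj.homology (b + c))) :
    IsZero (K.obj.cycles b ⊗ L.obj.cycles c) := by
  let f := fromSingleCycles K b ⊗ₘ fromSingleCycles L c
  have hmono : Mono (f.hom.f (b + c)) := by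
    have h1 : Mono ((fromSingleCycles K b).hom.f b ⊗ₘ (fromSingleCycles L c).hom.f c) := by
      have := BiexactTensor.left (C := C)
      have := BiexactTensor.right (C := C)
      have h2 (Y : C) : Mono ((fromSingleCycles K b).hom.f b ▷ Y) :=
        (tensorRight Y).map_mono _
      have h3 (Y : C) : Mono (Y ◁ (fromSingleCycles L c).hom.f c) :=
        (tensorLeft Y).map_mono _
      rw [MonoidalCategory.tensorHom_def]
      infer_instance
    have h2 := ιBd_tensorHom (fromSingleCycles K b) (fromSingleCycles L c) b c (b + c) rfl
    have h3 : Mono (ιBd _ _ b c (b + c) rfl ≫ f.hom.f (b + c)) := by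
      rw [h2]
      exact mono_comp _ (ιBd _ _ b c (b + c) rfl)
    -- A monomorphism cannot be tested on one summand of its source in general; here the source
    -- consists of a single summand, so its inclusion is an isomorphism.
    exact (MorphismProperty.cancel_left_of_respectsIso (MorphismProperty.monomorphisms C)
      (ιBd (singleChB b (K.obj.cycles b)) _ b c (b + c) rfl) _).1 h3
  have hz : IsZero ((K ⊗ L).obj.X (b + c - 1)) := isZero_tensor_X _ _ _ (fun i j hij => by
    by_cases hi : i < b
    · exact Or.inl (hK i hi)
    · exact Or.inr (hL j (by omega)))
  have hz' : IsZero ((singleChB b (K.obj.cycles b) ⊗ singleChB c (L.obj.cycles c)).obj.X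
      (b + c + 1)) := isZero_tensor_X _ _ _ (fun i j hij => by
    by_cases hi : i = b
    · exact Or.inr (isZero_singleChB _ _ _ (by omega))
    · exact Or.inl (isZero_singleChB _ _ _ hi))
  have hd : Mono ((K ⊗ L).obj.d (b + c) (b + c + 1)) := by
    have := (exactAt_iff_isZero_homology _ _).2 h
    rw [exactAt_iff' _ (b + c - 1) (b + c) (b + c + 1) (by simp) (by simp)] at this
    exact this.mono_g (hz.eq_of_src _ _)
  have h0 : f.hom.f (b + c) = 0 := by
    rw [← cancel_mono ((K ⊗ L).obj.d (b + c) (b + c + 1)), zero_comp, f.hom.comm,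
      hz'.eq_of_src (f.hom.f (b + c + 1)) 0, comp_zero]
  have h1 := IsZero.of_mono_eq_zero _ h0
  refine h1.of_iso ((?_ : _ ≅ _) ≪≫ asIso (ιBd _ _ b c (b + c) rfl))
  exact (singleObjXSelf (ComplexShape.up ℤ) b _).symm ⊗ᵢ (singleObjXSelf (ComplexShape.up ℤ) c _).symm

end Kunneth

/-! ### Extreme cohomology of tensor products in the bounded derived category. -/

section Cohomology

variable {C : Type u₁} [Category.{v₁} C] [Abelian C] [HasDerivedCategory.{w₁} C]

lemma exists_iso_QB (X : Bounded C) (a b : ℤ) (ha : (tB C).IsGE X a) (hb : (tB C).IsLE X b) :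
    ∃ K : ChB C, (∀ i, i < a → IsZero (K.obj.X i)) ∧ (∀ i, b < i → IsZero (K.obj.X i)) ∧
      Nonempty (X ≅ (QB C).obj K) := by
  rw [tB_isGE_iff] at ha
  rw [tB_isLE_iff] at hb
  obtain ⟨K, h1, h2, ⟨e⟩⟩ := exists_iso_Q_obj_of_isGE_of_isLE X.obj a b
  exact ⟨⟨K, (bddProp_iff _).2 ⟨a, b, h1, h2⟩⟩, fun i hi => K.isZero_of_isStrictlyGE a i hi,
    fun i hi => K.isZero_of_isStrictlyLE b i hi, ⟨TStructure.t.bounded.isoMk e⟩⟩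

/-- The cohomology of an object of the bounded derived category. -/
noncomputable abbrev coh (X : Bounded C) (n : ℤ) : C := (homologyFunctor C n).obj X.obj

/-- Isomorphic objects have isomorphic cohomology. -/
noncomputable def cohIso {X Y : Bounded C} (e : X ≅ Y) (n : ℤ) : coh X n ≅ coh Y n :=
  (Bounded.ι ⋙ homologyFunctor C n).mapIso e

/-- The cohomology of a bounded complex. -/
noncomputable def cohQB (K : ChB C) (n : ℤ) : coh ((QB C).obj K) n ≅ K.obj.homology n :=
  (homologyFunctorFactors C n).app K.obj

variable [MonoidalCategory C] [MonoidalPreadditive C] [BiexactTensor C]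

/-- Representing the objects by complexes that stop in degrees `b` and `c` turns their top
cohomology into opcycles, to which the statement on complexes applies. Thus top degrees add whenever
`C` has no zero divisors. -/
lemma coh_tensor_top (hC : ∀ X Y : C, ¬ IsZero X → ¬ IsZero Y → ¬ IsZero (X ⊗ Y))
    (X Y : Bounded C) (b c : ℤ) (hb : (tB C).IsLE X b) (hc : (tB C).IsLE Y c)
    (hX : ¬ IsZero (coh X b)) (hY : ¬ IsZero (coh Y c)) : ¬ IsZero (coh (X ⊗ Y) (b + c)) := by
  obtain ⟨a, -, ha, -⟩ := tB_bounded X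
  obtain ⟨a', -, ha', -⟩ := tB_bounded Y
  obtain ⟨K, -, hK, ⟨e⟩⟩ := exists_iso_QB X a b ha hb
  obtain ⟨L, -, hL, ⟨e'⟩⟩ := exists_iso_QB Y a' c ha' hc
  intro h
  have key (K : ChB C) (b : ℤ) (hK : ∀ i, b < i → IsZero (K.obj.X i)) (X : Bounded C)
      (e : X ≅ (QB C).obj K) (hX : ¬ IsZero (coh X b)) : ¬ IsZero (K.obj.opcycles b) := by
    -- The differential out of the top degree is zero, so cohomology there is all of the opcycles.
    have := K.obj.isIso_homologyι b _ rfl ((hK _ (by simp)).eq_of_tgt _ _)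
    exact fun h => hX (h.of_iso (cohIso e b ≪≫ cohQB K b ≪≫ asIso (K.obj.homologyι b)))
  refine hC _ _ (key K b hK X e hX) (key L c hL Y e' hY) (isZero_tensor_opcycles K L b c hK hL ?_)
  exact h.of_iso ((cohQB _ _).symm ≪≫
    cohIso ((Functor.Monoidal.μIso (QB C) K L).symm ≪≫ (e ⊗ᵢ e').symm) (b + c))

lemma coh_tensor_bot (hC : ∀ X Y : C, ¬ IsZero X → ¬ IsZero Y → ¬ IsZero (X ⊗ Y))
    (X Y : Bounded C) (b c : ℤ) (hb : (tB C).IsGE X b) (hc : (tB C).IsGE Y c)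
    (hX : ¬ IsZero (coh X b)) (hY : ¬ IsZero (coh Y c)) : ¬ IsZero (coh (X ⊗ Y) (b + c)) := by
  obtain ⟨-, a, -, ha⟩ := tB_bounded X
  obtain ⟨-, a', -, ha'⟩ := tB_bounded Y
  obtain ⟨K, hK, -, ⟨e⟩⟩ := exists_iso_QB X b a hb ha
  obtain ⟨L, hL, -, ⟨e'⟩⟩ := exists_iso_QB Y c a' hc ha'
  intro h
  have key (K : ChB C) (b : ℤ) (hK : ∀ i, i < b → IsZero (K.obj.X i)) (X : Bounded C)
      (e : X ≅ (QB C).obj K) (hX : ¬ IsZero (coh X b)) : ¬ IsZero (K.obj.cycles b) := by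
    -- The differential into the bottom degree is zero, so cohomology there is all of the cycles.
    have := K.obj.isIso_homologyπ _ b rfl ((hK _ (by simp)).eq_of_src _ _)
    exact fun h => hX (h.of_iso (cohIso e b ≪≫ cohQB K b ≪≫ (asIso (K.obj.homologyπ b)).symm))
  refine hC _ _ (key K b hK X e hX) (key L c hL Y e' hY) (isZero_tensor_cycles K L b c hK hL ?_)
  exact h.of_iso ((cohQB _ _).symm ≪≫
    cohIso ((Functor.Monoidal.μIso (QB C) K L).symm ≪≫ (e ⊗ᵢ e').symm) (b + c))

end Cohomology

/-! ### Simplicity of the unit object and absence of zero divisors. -/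

section Unit

/-- A morphism `f : S ⟶ 𝟙` followed by `g : 𝟙 ⟶ T` factors through `S ⊗ T`. -/
lemma comp_eq_whiskers {C : Type u₁} [Category.{v₁} C] [MonoidalCategory C] {S T : C}
    (f : S ⟶ 𝟙_ C) (g : 𝟙_ C ⟶ T) :
    f ≫ g = (ρ_ S).inv ≫ (S ◁ g ≫ f ▷ T) ≫ (λ_ T).hom := by
  rw [whisker_exchange]
  simp [unitors_equal]

variable {C : Type u₁} [Category.{v₁} C] [Abelian C] [MonoidalCategory C]
  [MonoidalPreadditive C]

section Biexact

variable [BiexactTensor C]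

lemma epi_whiskerLeft (X : C) {Y Z : C} (f : Y ⟶ Z) [Epi f] : Epi (X ◁ f) :=
  have := BiexactTensor.left X
  (tensorLeft X).map_epi f

lemma epi_whiskerRight {Y Z : C} (f : Y ⟶ Z) [Epi f] (X : C) : Epi (f ▷ X) :=
  have := BiexactTensor.right X
  (tensorRight X).map_epi f

lemma mono_whiskerRight {Y Z : C} (f : Y ⟶ Z) [Mono f] (X : C) : Mono (f ▷ X) :=
  have := BiexactTensor.right X
  (tensorRight X).map_mono f

/-- Tensoring with `S` is exact, so the cokernel of `S ◁ f` is `S ⊗ cokernel f`. -/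
lemma epi_whiskerLeft_of_isZero {S Y Z : C} (f : Y ⟶ Z) (h : IsZero (S ⊗ cokernel f)) :
    Epi (S ◁ f) :=
  have := BiexactTensor.left S
  ((ShortComplex.exact_cokernel f).map (tensorLeft S)).epi_f (h.eq_of_tgt _ _)

/-- Up to unitors, `f ≫ g` is an epimorphism onto `S ⊗ T` followed by a monomorphism out of it, so
`S ⊗ T` is its image. -/
lemma isZero_tensor_of_comp_eq_zero {S T : C} (f : S ⟶ 𝟙_ C) [Mono f] (g : 𝟙_ C ⟶ T) [Epi g]
    (h : f ≫ g = 0) : IsZero (S ⊗ T) := by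
  have h1 : S ◁ g ≫ f ▷ T = 0 := by
    rw [← cancel_epi (ρ_ S).inv, ← cancel_mono (λ_ T).hom, Category.assoc, ← comp_eq_whiskers, h]
    simp
  have := epi_whiskerLeft S g
  have := mono_whiskerRight f T
  have h2 : f ▷ T = 0 := by rw [← cancel_epi (S ◁ g), h1, comp_zero]
  exact IsZero.of_mono_eq_zero _ h2

end Biexact

variable [RigidCategory C]

/-- The composite in the hypothesis is, up to a unitor, the transpose of `g` under the duality
adjunction. -/
lemma eq_zero_of_coevaluation {S T : C} (g : Sᘁ ⟶ T) (h : η_ S Sᘁ ≫ S ◁ g = 0) : g = 0 := by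
  rw [← cancel_epi (ρ_ Sᘁ).hom, comp_zero]
  apply (tensorLeftHomEquiv (𝟙_ C) S Sᘁ T).injective
  have h0 : (tensorLeftHomEquiv (𝟙_ C) S Sᘁ T) ((ρ_ Sᘁ).hom ≫ g) = η_ S Sᘁ ≫ S ◁ g := by
    simp [tensorLeftHomEquiv, unitors_inv_equal]
  have h0' : (tensorLeftHomEquiv (𝟙_ C) S Sᘁ T) 0 = 0 := by
    simp [tensorLeftHomEquiv]
  rw [h0, h0', h]

/-- By the zigzag identity, the identity of `S` factors through `(S ⊗ Sᘁ) ⊗ S`. -/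
lemma isZero_of_tensor_dual {S : C} (h : IsZero (S ⊗ Sᘁ)) : IsZero S := by
  have h1 := ExactPairing.evaluation_coevaluation S Sᘁ
  rw [h.eq_of_tgt (η_ S Sᘁ) 0, MonoidalPreadditive.zero_whiskerRight, zero_comp] at h1
  rw [IsZero.iff_id_eq_zero, ← cancel_epi (λ_ S).hom, ← cancel_mono (ρ_ S).inv]
  simp [← h1]

lemma evaluation_ne_zero {S : C} (h : ¬ IsZero S) : ε_ S Sᘁ ≠ 0 := by
  intro h0
  have h1 := ExactPairing.evaluation_coevaluation S Sᘁ
  rw [h0, MonoidalPreadditive.whiskerLeft_zero, comp_zero, comp_zero] at h1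
  refine h ?_
  rw [IsZero.iff_id_eq_zero, ← cancel_epi (λ_ S).hom, ← cancel_mono (ρ_ S).inv]
  simp [← h1]

/-- Composing the inclusion `i` with its transpose `q : 𝟙 ⟶ Sᘁ` gives an isomorphism `S ≅ Sᘁ`. So
`S` is a retract of the unit, hence the image of an idempotent of `End 𝟙`, and such idempotents are
trivial. -/
lemma isIso_of_simple_unit_ideal (hid : ∀ e : 𝟙_ C ⟶ 𝟙_ C, e ≫ e = e → e = 0 ∨ e = 𝟙 _)
    {S : C} [Simple S] (i : S ⟶ 𝟙_ C) [Mono i] : IsIso i := by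
  let q : 𝟙_ C ⟶ Sᘁ := η_ S Sᘁ ≫ i ▷ Sᘁ ≫ (λ_ Sᘁ).hom
  -- Transposing back and using that `i ▷ T` is a monomorphism, `q ≫ g = 0` forces `g = 0`; this is
  -- why `q` is an epimorphism.
  have hS : ¬ IsZero S := Simple.not_isZero S
  have hq : Epi q := by
    refine Preadditive.epi_of_cancel_zero _ (fun {T} g hg => eq_zero_of_coevaluation g ?_)
    have := mono_whiskerRight i T
    rw [← cancel_mono (i ▷ T), ← cancel_mono (λ_ T).hom, Category.assoc, Category.assoc,
      whisker_exchange_assoc]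
    simpa [q] using hg
  have hne : i ≫ q ≠ 0 := fun h => hS (isZero_of_tensor_dual
    (isZero_tensor_of_comp_eq_zero i q h))
  have hmono : Mono (i ≫ q) := mono_of_nonzero_from_simple hne
  -- Since `i` composed with its cokernel is zero, `S` annihilates the cokernel. Hence `S ◁ i` is an
  -- epimorphism, so `i` can be cancelled after tensoring with `S`.
  have hV : IsZero (S ⊗ cokernel i) :=
    isZero_tensor_of_comp_eq_zero i (cokernel.π i) (cokernel.condition i)
  have hi : Epi (S ◁ i) := epi_whiskerLeft_of_isZero i hV
  have hepi : Epi (i ≫ q) := by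
    refine Preadditive.epi_of_cancel_zero _ (fun {T} g hg => eq_zero_of_coevaluation g ?_)
    have := epi_whiskerLeft S q
    have h1 : S ◁ i ≫ S ◁ q ≫ S ◁ g = 0 := by
      rw [← whiskerLeft_comp, ← whiskerLeft_comp, ← Category.assoc, hg,
        MonoidalPreadditive.whiskerLeft_zero]
    have h2 : S ◁ g = 0 := by
      rw [← cancel_epi (S ◁ q), ← cancel_epi (S ◁ i), h1, comp_zero, comp_zero]
    rw [h2, comp_zero]
  have hiso : IsIso (i ≫ q) := isIso_of_mono_of_epi _
  have h1 : i ≫ q ≫ inv (i ≫ q) = 𝟙 _ := by rw [← Category.assoc, IsIso.hom_inv_id]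
  -- The projector of the unit onto `S`: if it is zero then so is `i`, and if it is the identity
  -- then `i` is invertible.
  obtain h | h := hid (q ≫ inv (i ≫ q) ≫ i) (by
    simp only [Category.assoc]
    rw [reassoc_of% h1])
  · have h2 : i = 0 := by
      have := i ≫= h
      rwa [reassoc_of% h1, comp_zero] at this
    exact (hS (IsZero.of_mono_eq_zero i h2)).elim
  · exact ⟨q ≫ inv (i ≫ q), h1, by rw [Category.assoc, h]⟩

lemma not_isZero_unit (k : Type t) [Field k] [Linear k C] [MonoidalLinear k C] [IsTensorCategory k C] :
    ¬ IsZero (𝟙_ C) := by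
  obtain ⟨e⟩ := IsTensorCategory.end_unit (k := k) (C := C)
  intro h
  have : (1 : End (𝟙_ C)) = 0 := h.eq_of_src _ _
  exact one_ne_zero (e.injective (by rw [map_one, map_zero, this]))

/-- The unit has finite length, hence contains a simple subobject. This is the whole unit, because
`End 𝟙` is a field and so has no nontrivial idempotent. -/
lemma simple_unit (k : Type t) [Field k] [Linear k C] [MonoidalLinear k C] [IsTensorCategory k C] :
    Simple (𝟙_ C) := by
  obtain ⟨e⟩ := IsTensorCategory.end_unit (k := k) (C := C)
  have := (IsTensorCategory.finite_length k (𝟙_ C)).2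
  obtain ⟨Y, hY⟩ := exists_simple_subobject (not_isZero_unit (C := C) k)
  have : IsIso Y.arrow := isIso_of_simple_unit_ideal (fun f hf => by
    have h : IsIdempotentElem (e.symm f) := by
      change e.symm f * e.symm f = e.symm f
      rw [← map_mul]
      exact congrArg _ hf
    obtain h | h := IsIdempotentElem.iff_eq_zero_or_one.1 h
    · exact Or.inl ((map_eq_zero_iff e.symm e.symm.injective).1 h)
    · exact Or.inr ((map_eq_one_iff e.symm e.symm.injective).1 h)) Y.arrow
  exact Simple.of_iso (asIso Y.arrow).symm

/-- In a tensor category, the tensor product of nonzero objects is nonzero. -/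
lemma not_isZero_tensor (k : Type t) [Field k] [Linear k C] [MonoidalLinear k C] [IsTensorCategory k C]
    (X Y : C) (hX : ¬ IsZero X) (hY : ¬ IsZero Y) : ¬ IsZero (X ⊗ Y) := by
  intro h
  have := simple_unit (C := C) k
  -- A nonzero evaluation maps onto the simple unit, so `Xᘁ ⊗ X ⊗ Y` maps onto `Y`; if `X ⊗ Y`
  -- vanished, so would `Y`.
  have : Epi (ε_ X Xᘁ) := epi_of_nonzero_to_simple (evaluation_ne_zero hX)
  have h1 := epi_whiskerRight (ε_ X Xᘁ) Y
  have h2 : IsZero ((Xᘁ ⊗ X) ⊗ Y) := (isZero_tensor_right Xᘁ h).of_iso (α_ _ _ _)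
  have h3 : IsZero (𝟙_ C ⊗ Y) := IsZero.of_epi (ε_ X Xᘁ ▷ Y) h2
  exact hY (h3.of_iso (λ_ Y).symm)

end Unit

/-! ### Finite length and uniform amplitude. -/

section FiniteLength

variable {A : Type u₁} [Category.{v₁} A] [Abelian A]

/-- The strictly monotone map induced by a faithful exact functor on subobjects. -/
lemma exists_strictMono_subobject {B : Type u₂} [Category.{v₂} B] (F : A ⥤ B) [F.Faithful]
    [F.PreservesMonomorphisms] (X : A) :
    ∃ f : Subobject X → Subobject (F.obj X), StrictMono f := by
  refine ⟨fun U => Subobject.mk (F.map U.arrow), fun U V h => lt_of_le_not_ge ?_ fun h' => ?_⟩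
  · exact Subobject.mk_le_mk_of_comm (F.map (U.ofLE V h.le)) (by
      rw [← F.map_comp, Subobject.ofLE_arrow])
  -- If the images coincide, `F` sends the inclusion of `U` in `V` to a split epimorphism. A
  -- faithful functor reflects epimorphisms, so the inclusion is an isomorphism.
  · let w := Subobject.ofMkLEMk _ _ h'
    have hw : w ≫ F.map U.arrow = F.map V.arrow := Subobject.ofMkLEMk_comp h'
    have h1 : w ≫ F.map (U.ofLE V h.le) = 𝟙 _ := by
      rw [← cancel_mono (F.map V.arrow), Category.assoc, ← F.map_comp, Subobject.ofLE_arrow, hw,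
        Category.id_comp]
    have h2 : Epi (F.map (U.ofLE V h.le)) := ⟨fun a b hab => by
      rw [← Category.id_comp a, ← h1, Category.assoc, hab, ← Category.assoc, h1, Category.id_comp]⟩
    have := F.epi_of_epi_map h2
    have := isIso_of_mono_of_epi (U.ofLE V h.le)
    exact h.not_ge (Subobject.le_of_comm (inv (U.ofLE V h.le)) (by
      rw [IsIso.inv_comp_eq, Subobject.ofLE_arrow]))

/-- A strictly monotone map reflects well-foundedness. Finite length in the abelian subcategories is
obtained in this way from the ambient tensor category. -/
lemma isNoetherianObject_of_map {B : Type u₂} [Category.{v₂} B] (F : A ⥤ B) [F.Faithful]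
    [F.PreservesMonomorphisms] (X : A) [IsNoetherianObject (F.obj X)] : IsNoetherianObject X := by
  obtain ⟨f, hf⟩ := exists_strictMono_subobject F X
  exact ⟨hf.wellFoundedGT⟩

lemma isArtinianObject_of_map {B : Type u₂} [Category.{v₂} B] (F : A ⥤ B) [F.Faithful]
    [F.PreservesMonomorphisms] (X : A) [IsArtinianObject (F.obj X)] : IsArtinianObject X := by
  obtain ⟨f, hf⟩ := exists_strictMono_subobject F X
  exact ⟨hf.wellFoundedLT⟩

/-- Dévissage: a property of objects which holds for zero and simple objects and which is stable
by extensions holds for all objects of finite length. -/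
lemma finite_length_induction [∀ X : A, IsArtinianObject X] (P : ObjectProperty A)
    (zero : ∀ X, IsZero X → P X) (simple : ∀ X, Simple X → P X)
    (ext : ∀ S : ShortComplex A, S.ShortExact → P S.X₁ → P S.X₃ → P S.X₂)
    (iso : ∀ X Y, (X ≅ Y) → P X → P Y) (X : A) [IsNoetherianObject X] : P X := by
  -- Take a maximal subobject `U` with the property. If it were proper, the preimage in `X` of a
  -- simple subobject of `X / U` would be an extension of a simple object by `U`, hence a larger
  -- subobject with the property.
  obtain ⟨U, hU, hmax⟩ := (wellFounded_gt (α := Subobject X)).has_min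
    {U | P (U : A)} ⟨⊥, zero _ ((isZero_zero A).of_iso Subobject.botCoeIsoZero)⟩
  by_cases hZ : IsZero (cokernel U.arrow)
  · have := Preadditive.epi_of_isZero_cokernel U.arrow hZ
    have := isIso_of_mono_of_epi U.arrow
    exact iso _ _ (asIso U.arrow) hU
  obtain ⟨Y, hY⟩ := exists_simple_subobject hZ
  let q := cokernel.π U.arrow
  let f : (U : A) ⟶ pullback q Y.arrow := pullback.lift U.arrow 0 (by simp [q])
  have hf : f ≫ pullback.fst q Y.arrow = U.arrow := pullback.lift_fst _ _ _
  have : Mono f := mono_of_mono_fac hf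
  let S : ShortComplex A := ShortComplex.mk f (pullback.snd q Y.arrow) (pullback.lift_snd _ _ _)
  have hS : S.ShortExact := by
    refine { exact := S.exact_of_f_is_kernel (KernelFork.IsLimit.ofι' f _ fun {T} g hg => ?_)
             mono_f := by assumption
             epi_g := by dsimp [S]; infer_instance }
    have h : (g ≫ pullback.fst q Y.arrow) ≫ q = 0 := by
      rw [Category.assoc, pullback.condition, reassoc_of% hg, zero_comp]
    refine ⟨Abelian.monoLift U.arrow _ h, ?_⟩
    rw [← cancel_mono (pullback.fst q Y.arrow), Category.assoc, hf, Abelian.monoLift_comp]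
  refine (hmax (Subobject.mk (pullback.fst q Y.arrow)) ?_ (lt_of_le_not_ge ?_ fun h => ?_)).elim
  · exact iso _ _ (Subobject.underlyingIso _).symm (ext S hS hU (simple _ hY))
  · exact Subobject.le_mk_of_comm f hf
  -- If the preimage were contained in `U`, it would die in `X / U`; but it maps onto `Y`, which is
  -- nonzero.
  · have h1 : pullback.snd q Y.arrow ≫ Y.arrow = 0 := by
      rw [← pullback.condition, ← Subobject.ofMkLE_arrow h, Category.assoc, cokernel.condition,
        comp_zero]
    have h2 : Y.arrow = 0 := by
      rw [← cancel_epi (pullback.snd q Y.arrow), h1, comp_zero]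
    exact Simple.not_isZero (Y : A) (IsZero.of_mono_eq_zero _ h2)

open Pretriangulated Triangulated ZeroObject

/-- An exact functor from an abelian category with finitely many simple objects to a category with
a bounded t-structure has bounded amplitude. -/
lemma exists_uniform_amplitude [∀ X : A, IsArtinianObject X] [∀ X : A, IsNoetherianObject X]
    (hA : FinitelyManySimples A) {T : Type u₂} [Category.{v₂} T] [Preadditive T]
    [HasZeroObject T] [HasShift T ℤ] [∀ n : ℤ, (shiftFunctor T n).Additive] [Pretriangulated T]
    (t : TStructure T) (ht : ∀ X, ∃ a b, t.IsGE X a ∧ t.IsLE X b) (Φ : A ⥤ T)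
    [Φ.PreservesZeroMorphisms]
    (hΦ : ∀ S : ShortComplex A, S.ShortExact →
      ∃ δ, Triangle.mk (Φ.map S.f) (Φ.map S.g) δ ∈ distTriang T) :
    ∃ a b, ∀ X, t.IsGE (Φ.obj X) a ∧ t.IsLE (Φ.obj X) b := by
  obtain ⟨n, S, hS⟩ := hA
  choose a b hab using fun j => ht (Φ.obj (S j))
  -- There are finitely many simple objects, so their individual bounds have common ones; extensions
  -- stay within them by the long exact sequence.
  obtain ⟨a', ha'⟩ := (Set.finite_range a).bddBelow
  obtain ⟨b', hb'⟩ := (Set.finite_range b).bddAbove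
  refine ⟨a', b', fun X => finite_length_induction (fun X => t.IsGE (Φ.obj X) a' ∧
    t.IsLE (Φ.obj X) b') (fun X hX => ?_) (fun X hX => ?_) (fun S hS h₁ h₃ => ?_)
    (fun X Y e h => ?_) X⟩
  · exact ⟨t.isGE_of_isZero (Φ.map_isZero hX) _, t.isLE_of_isZero (Φ.map_isZero hX) _⟩
  · obtain ⟨j, ⟨e⟩⟩ := hS X hX
    obtain ⟨h1, h2⟩ := hab j
    have := t.isGE_of_ge (Φ.obj (S j)) a' (a j) (ha' ⟨j, rfl⟩)
    have := t.isLE_of_le (Φ.obj (S j)) (b j) b' (hb' ⟨j, rfl⟩)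
    exact ⟨t.isGE_of_iso (Φ.mapIso e.symm) _, t.isLE_of_iso (Φ.mapIso e.symm) _⟩
  · obtain ⟨δ, hδ⟩ := hΦ S hS
    exact ⟨t.isGE₂ _ hδ _ h₁.1 h₃.1, t.isLE₂ _ hδ _ h₁.2 h₃.2⟩
  · obtain ⟨h1, h2⟩ := h
    exact ⟨t.isGE_of_iso (Φ.mapIso e) _, t.isLE_of_iso (Φ.mapIso e) _⟩

end FiniteLength

/-! ### Exactness and bilinearity of actions. -/

section BiexactActions

open MonoidalLeftAction Functor.LaxLeftLinear Functor.LeftLinear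

section

variable {A : Type u₁} [Category.{v₁} A] {B : Type u₂} [Category.{v₂} B] [Abelian B]
  {C : Type u₃} [Category.{v₃} C]

/-- A faithful functor on an abelian category reflects isomorphisms, so if it preserves finite
limits it also reflects them. -/
lemma preservesFiniteLimits_of_comp_faithful (H : A ⥤ B) (i : B ⥤ C) [i.Faithful] [PreservesFiniteLimits i]
    [PreservesFiniteLimits (H ⋙ i)] : PreservesFiniteLimits H :=
  have : ReflectsFiniteLimits i := ⟨fun _ _ _ => inferInstance⟩
  preservesFiniteLimits_of_reflects_of_preserves H i

lemma preservesFiniteColimits_of_comp_faithful (H : A ⥤ B) (i : B ⥤ C) [i.Faithful] [PreservesFiniteColimits i]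
    [PreservesFiniteColimits (H ⋙ i)] : PreservesFiniteColimits H :=
  have : ReflectsFiniteColimits i :=
    { reflects := fun _ _ _ => inferInstance }
  preservesFiniteColimits_of_reflects_of_preserves H i

end

section

variable {C : Type u₃} [Category.{v₃} C] [MonoidalCategory C]
  {A : Type u₁} [Category.{v₁} A] {B : Type u₂} [Category.{v₂} B]
  [MonoidalLeftAction C A] [MonoidalLeftAction C B] (i : A ⥤ B) [i.LeftLinear C]

/-- A module functor commutes with the action of an object. -/
noncomputable def compActionLeftIso (X : C) : i ⋙ actionLeft B X ≅ actionLeft A X ⋙ i :=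
  NatIso.ofComponents (fun a => μₗIso i X a) (fun f => μₗ_naturality_right i X f)

/-- A module functor commutes with the orbit functors. -/
noncomputable def actionRightCompIso (a : A) : actionRight C (i.obj a) ≅ actionRight C a ⋙ i :=
  NatIso.ofComponents (fun X => μₗIso i X a) (fun f => μₗ_naturality_left i f a)

end

variable {A : Type u₁} [Category.{v₁} A] [Abelian A] {B : Type u₂} [Category.{v₂} B] [Abelian B]
  {C : Type u₃} [Category.{v₃} C] [Abelian C] [MonoidalCategory C]
  [MonoidalLeftAction C A] [MonoidalLeftAction C B] (i : A ⥤ B)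
  [i.LeftLinear C]

/-- Followed by `i`, the two partial action functors of `A` become those of `B`, and both additivity
and exactness can be tested after `i`. With `B = C` acting on itself, this handles the action on the
subcategory of a tensor category. -/
lemma IsBiexactAction.of_faithful [i.Additive] [i.Faithful] [PreservesFiniteLimits i]
    [PreservesFiniteColimits i] (h : IsBiexactAction C B) : IsBiexactAction C A where
  additive_left X :=
    have := h.additive_left X
    have := Functor.additive_of_iso (compActionLeftIso i X)
    Functor.additive_of_comp_faithful _ i
  additive_right a :=
    have := h.additive_right (i.obj a)
    have := Functor.additive_of_iso (actionRightCompIso (C := C) i a)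
    Functor.additive_of_comp_faithful _ i
  exact_left X := by
    obtain ⟨_, _⟩ := h.exact_left X
    have := preservesFiniteLimits_of_natIso (compActionLeftIso i X)
    have := preservesFiniteColimits_of_natIso (compActionLeftIso i X)
    exact ⟨preservesFiniteLimits_of_comp_faithful _ i,
      preservesFiniteColimits_of_comp_faithful _ i⟩
  exact_right a := by
    obtain ⟨_, _⟩ := h.exact_right (i.obj a)
    have := preservesFiniteLimits_of_natIso (actionRightCompIso (C := C) i a)
    have := preservesFiniteColimits_of_natIso (actionRightCompIso (C := C) i a)
    exact ⟨preservesFiniteLimits_of_comp_faithful _ i,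
      preservesFiniteColimits_of_comp_faithful _ i⟩

lemma IsBilinearAction.of_faithful {k : Type t} [Field k] [Linear k C] [Linear k A] [Linear k B]
    [i.Linear k] [i.Faithful] (h : IsBilinearAction k C B) : IsBilinearAction k C A where
  linear_left X :=
    have := h.linear_left X
    have := Functor.linear_of_iso k (compActionLeftIso i X)
    linear_of_comp_faithful _ i
  linear_right a :=
    have := h.linear_right (i.obj a)
    have := Functor.linear_of_iso k (actionRightCompIso (C := C) i a)
    linear_of_comp_faithful _ i

section Equivalence

variable (e : A ≌ B) [e.functor.LeftLinear C]

/-- The action of an object is transported by an equivalence of module categories. -/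
noncomputable def actionLeftIso (X : C) :
    e.inverse ⋙ actionLeft A X ⋙ e.functor ≅ actionLeft B X :=
  Functor.isoWhiskerLeft e.inverse (compActionLeftIso e.functor X).symm ≪≫
    (Functor.associator _ _ _).symm ≪≫ Functor.isoWhiskerRight e.counitIso _ ≪≫
    Functor.leftUnitor _

/-- The orbit functors are transported by an equivalence of module categories. -/
noncomputable def actionRightIso (b : B) :
    actionRight C (e.inverse.obj b) ⋙ e.functor ≅ actionRight C b :=
  (actionRightCompIso e.functor (e.inverse.obj b)).symm ≪≫
    (curriedAction C B).flip.mapIso (e.counitIso.app b)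

/-- This settles the second ideal: its action is defined through a functor of triangulated
categories, and exactness is obtained by transport from the first ideal. -/
lemma IsBiexactAction.of_equivalence [e.functor.Additive] (h : IsBiexactAction C A) :
    IsBiexactAction C B where
  additive_left X :=
    have := h.additive_left X
    Functor.additive_of_iso (actionLeftIso e X)
  additive_right b :=
    have := h.additive_right (e.inverse.obj b)
    Functor.additive_of_iso (actionRightIso (C := C) e b)
  exact_left X := by
    obtain ⟨_, _⟩ := h.exact_left X
    exact ⟨preservesFiniteLimits_of_natIso (actionLeftIso e X),
      preservesFiniteColimits_of_natIso (actionLeftIso e X)⟩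
  exact_right b := by
    obtain ⟨_, _⟩ := h.exact_right (e.inverse.obj b)
    exact ⟨preservesFiniteLimits_of_natIso (actionRightIso (C := C) e b),
      preservesFiniteColimits_of_natIso (actionRightIso (C := C) e b)⟩

lemma IsBilinearAction.of_equivalence {k : Type t} [Field k] [Linear k C] [Linear k A]
    [Linear k B] [e.functor.Additive] [e.functor.Linear k] (h : IsBilinearAction k C A) :
    IsBilinearAction k C B where
  linear_left X :=
    have := h.linear_left X
    Functor.linear_of_iso k (actionLeftIso e X)
  linear_right b :=
    have := h.linear_right (e.inverse.obj b)
    Functor.linear_of_iso k (actionRightIso (C := C) e b)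

end Equivalence

section Self

variable [MonoidalPreadditive C]

/-- Tensoring with a rigid object has adjoints on both sides, given by its two duals. -/
lemma isBiexactAction_self [RigidCategory C] : IsBiexactAction C C where
  additive_left X := inferInstanceAs (tensorLeft X).Additive
  additive_right X := inferInstanceAs (tensorRight X).Additive
  exact_left X :=
    have _ : (tensorLeft X).IsLeftAdjoint := (tensorLeftAdjunction (ᘁX) X).isLeftAdjoint
    have _ : (tensorLeft X).IsRightAdjoint := (tensorLeftAdjunction X (Xᘁ)).isRightAdjoint
    ⟨inferInstanceAs (PreservesFiniteLimits (tensorLeft X)),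
      inferInstanceAs (PreservesFiniteColimits (tensorLeft X))⟩
  exact_right X :=
    have _ : (tensorRight X).IsLeftAdjoint := (tensorRightAdjunction X (Xᘁ)).isLeftAdjoint
    have _ : (tensorRight X).IsRightAdjoint := (tensorRightAdjunction (ᘁX) X).isRightAdjoint
    ⟨inferInstanceAs (PreservesFiniteLimits (tensorRight X)),
      inferInstanceAs (PreservesFiniteColimits (tensorRight X))⟩

lemma isBilinearAction_self (k : Type t) [Field k] [Linear k C] [MonoidalLinear k C] :
    IsBilinearAction k C C where
  linear_left X := inferInstanceAs ((tensorLeft X).Linear k)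
  linear_right X := inferInstanceAs ((tensorRight X).Linear k)

end Self

end BiexactActions

/-! ### Monoidal functors as module functors. -/

section MonoidalModule

open Functor.LaxMonoidal Functor.OplaxMonoidal

variable {C : Type u₁} [Category.{v₁} C] [MonoidalCategory C]
  {D : Type u₂} [Category.{v₂} D] [MonoidalCategory D] (φ : C ⥤ D) [φ.Monoidal]

/-- A monoidal functor is a module functor. -/
@[reducible]
noncomputable def leftLinearAlongSelf : LeftLinearAlong φ φ :=
  letI := restrictAction φ D
  letI : φ.LaxLeftLinear C :=
    { μₗ X m := μ φ X m
      μₗ_naturality_left f m := μ_natural_left φ f m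
      μₗ_naturality_right X _ _ f := μ_natural_right φ X f
      μₗ_associativity X Y m := by
        have h := Functor.LaxMonoidal.associativity φ X Y m
        have h' : δ φ X Y ▷ φ.obj m ≫ μ φ X Y ▷ φ.obj m = 𝟙 _ := by
          rw [← comp_whiskerRight, Functor.Monoidal.δ_μ, id_whiskerRight]
        change μ φ (X ⊗ Y) m ≫ φ.map (α_ X Y m).hom = (δ φ X Y ▷ φ.obj m ≫ (α_ _ _ _).hom) ≫
          φ.obj X ◁ μ φ Y m ≫ μ φ X (Y ⊗ m)
        rw [Category.assoc, ← h, reassoc_of% h']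
      μₗ_unitality m := by
        change η φ ▷ φ.obj m ≫ (λ_ (φ.obj m)).hom = μ φ (𝟙_ C) m ≫ φ.map (λ_ m).hom
        rw [Functor.LaxMonoidal.left_unitality φ m, ← comp_whiskerRight_assoc,
          Functor.Monoidal.η_ε, id_whiskerRight, Category.id_comp] }
  haveI (X : C) (m : C) : IsIso (Functor.LaxLeftLinear.μₗ φ X m) :=
    inferInstanceAs (IsIso (μ φ X m))
  leftLinearOfLax φ

end MonoidalModule

/-! ### Existence of the restricted action. -/

section Existence

open MonoidalLeftAction

lemma exists_action {C : Type u₁} [Category.{v₁} C] [MonoidalCategory C] {A : Type u₂}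
    [Category.{v₂} A] {M : Type u₃} [Category.{v₃} M] [MonoidalLeftAction C M] (j : A ⥤ M)
    [j.Full] [j.Faithful] (h : ∀ (X : C) a, j.essImage (X ⊙ₗ j.obj a)) :
    ∃ (_ : MonoidalLeftAction C A), Nonempty (j.LeftLinear C) :=
  ⟨inducedAction j (fun X a => (h X a).witness) (fun X a => (h X a).getIso),
    ⟨inducedActionLeftLinear j _ _⟩⟩

end Existence

/-! ### Objects that preserve a family of uniformly bounded amplitude. -/

section Amplitude

variable {C : Type u₁} [Category.{v₁} C] [Abelian C] [HasDerivedCategory.{w₁} C]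

lemma mem_essImage_degZero_iff (X : Bounded C) :
    (degZero C).essImage X ↔ (tB C).IsGE X 0 ∧ (tB C).IsLE X 0 := by
  refine ⟨?_, fun h => mem_essImage_degZero X h.1 h.2⟩
  rintro ⟨Y, ⟨e⟩⟩
  exact ⟨(tB C).isGE_of_iso e 0, (tB C).isLE_of_iso e 0⟩

lemma mem_essImage_degZero_of_isZero {X : Bounded C} (hX : IsZero X) :
    (degZero C).essImage X :=
  mem_essImage_degZero X ((tB C).isGE_of_isZero hX 0) ((tB C).isLE_of_isZero hX 0)

lemma exists_coh_of_not_isZero {X : Bounded C} (hX : ¬ IsZero X) : ∃ n, ¬ IsZero (coh X n) := by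
  by_contra! h
  refine hX ?_
  have := isZero_of_homology X.obj h
  rw [IsZero.iff_id_eq_zero] at this ⊢
  exact ObjectProperty.hom_ext _ this

lemma isZero_coh_of_isLE {X : Bounded C} {b n : ℤ} (h : (tB C).IsLE X b) (hn : b < n) :
    IsZero (coh X n) :=
  (isLE_iff _ _).1 ((tB_isLE_iff X b).1 h) n hn

lemma isZero_coh_of_isGE {X : Bounded C} {a n : ℤ} (h : (tB C).IsGE X a) (hn : n < a) :
    IsZero (coh X n) :=
  (isGE_iff _ _).1 ((tB_isGE_iff X a).1 h) n hn

lemma isLE_of_isZero_coh {X : Bounded C} {b : ℤ} (h : ∀ n, b < n → IsZero (coh X n)) :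
    (tB C).IsLE X b :=
  (tB_isLE_iff X b).2 ((isLE_iff _ _).2 h)

lemma isGE_of_isZero_coh {X : Bounded C} {a : ℤ} (h : ∀ n, n < a → IsZero (coh X n)) :
    (tB C).IsGE X a :=
  (tB_isGE_iff X a).2 ((isGE_iff _ _).2 h)

variable [MonoidalCategory C] [MonoidalPreadditive C] [BiexactTensor C]

/-- If tensoring with an object preserves a family of objects of uniformly bounded amplitude, then
this object is concentrated in degree zero. -/
lemma mem_essImage_degZero_of_family
    (hC : ∀ X Y : C, ¬ IsZero X → ¬ IsZero Y → ¬ IsZero (X ⊗ Y)) (Z : Bounded C) {ι : Type u₂}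
    (Φ : ι → Bounded C) (o : ι → ι) (e : ∀ i, Nonempty (Z ⊗ Φ i ≅ Φ (o i)))
    (hΦ : ∃ a b, ∀ i, (tB C).IsGE (Φ i) a ∧ (tB C).IsLE (Φ i) b) (h0 : ∃ i, ¬ IsZero (Φ i)) :
    (degZero C).essImage Z := by
  obtain ⟨a, b, hab⟩ := hΦ
  obtain ⟨i, hi⟩ := h0
  obtain ⟨n, hn⟩ := exists_coh_of_not_isZero hi
  obtain ⟨p, q, hp, hq⟩ := tB_bounded Z
  refine mem_essImage_degZero _ (isGE_of_isZero_coh fun m hm => ?_)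
    (isLE_of_isZero_coh fun m hm => ?_)
  · by_contra h
    -- Let `r` be the least degree in which the family has cohomology, attained at `i`, and let `s ≤
    -- m < 0` be the least one for `Z`. Then `Z ⊗ Φ i`, again in the family, has cohomology in
    -- degree `s + r < r`.
    obtain ⟨r, ⟨i, hr⟩, hr'⟩ := Int.exists_least_of_bdd (P := fun n => ∃ i, ¬ IsZero (coh (Φ i) n))
      ⟨a, fun z ⟨i, hz⟩ => not_lt.1 fun h => hz (isZero_coh_of_isGE (hab i).1 h)⟩ ⟨n, i, hn⟩
    obtain ⟨s, hs, hs'⟩ := Int.exists_least_of_bdd (P := fun n => ¬ IsZero (coh Z n))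
      ⟨p, fun z hz => not_lt.1 fun h => hz (isZero_coh_of_isGE hp h)⟩ ⟨m, h⟩
    have h1 := coh_tensor_bot hC Z (Φ i) s r
      (isGE_of_isZero_coh fun z hz => by_contra fun h => hz.not_ge (hs' z h))
      (isGE_of_isZero_coh fun z hz => by_contra fun h => hz.not_ge (hr' z ⟨i, h⟩)) hs hr
    obtain ⟨e⟩ := e i
    rw [(cohIso e _).isZero_iff] at h1
    have := hr' _ ⟨_, h1⟩
    have := hs' m h
    lia
  · by_contra h
    -- The mirror argument: the greatest degrees satisfy `s ≥ m > 0`, so `s + r > r`.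
    obtain ⟨r, ⟨i, hr⟩, hr'⟩ := Int.exists_greatest_of_bdd
      (P := fun n => ∃ i, ¬ IsZero (coh (Φ i) n))
      ⟨b, fun z ⟨i, hz⟩ => not_lt.1 fun h => hz (isZero_coh_of_isLE (hab i).2 h)⟩ ⟨n, i, hn⟩
    obtain ⟨s, hs, hs'⟩ := Int.exists_greatest_of_bdd (P := fun n => ¬ IsZero (coh Z n))
      ⟨q, fun z hz => not_lt.1 fun h => hz (isZero_coh_of_isLE hq h)⟩ ⟨m, h⟩
    have h1 := coh_tensor_top hC Z (Φ i) s r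
      (isLE_of_isZero_coh fun z hz => by_contra fun h => hz.not_ge (hs' z h))
      (isLE_of_isZero_coh fun z hz => by_contra fun h => hz.not_ge (hr' z ⟨i, h⟩)) hs hr
    obtain ⟨e⟩ := e i
    rw [(cohIso e _).isZero_iff] at h1
    have := hr' _ ⟨_, h1⟩
    have := hs' m h
    lia

end Amplitude

/-! ### Restriction of the action on a tensor ideal to its heart. -/

section Ideals

open MonoidalLeftAction Functor.LeftLinear

variable {C : Type u₁} [Category.{v₁} C] [Abelian C] [HasDerivedCategory.{w₁} C]
  [MonoidalCategory C] [MonoidalPreadditive C] [BiexactTensor C]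
  {A : Type u₂} [Category.{v₂} A] [Abelian A] [HasDerivedCategory.{w₂} A]
  [MonoidalLeftAction (Bounded C) (Bounded A)]

section

variable (iA : A ⥤ C) [iA.Additive] [PreservesFiniteLimits iA] [PreservesFiniteColimits iA]
  [(mapDb iA).LeftLinear (Bounded C)]

/-- The hearts are stable by the action on a triangulated tensor ideal. -/
lemma mem_essImage_degZero_act [iA.Faithful] (Z : Bounded C) (hZ : (degZero C).essImage Z)
    (a : A) : (degZero A).essImage (Z ⊙ₗ (degZero A).obj a) := by
  obtain ⟨Y, ⟨e⟩⟩ := hZ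
  -- Amplitude is tested in `Bounded C`, where the module functor `mapDb iA` turns the action into a
  -- tensor product of two objects in degree zero.
  rw [mem_essImage_degZero_iff, ← isGE_mapDb_iff iA, ← isLE_mapDb_iff iA,
    ← mem_essImage_degZero_iff]
  exact ⟨Y ⊗ iA.obj a, ⟨(Functor.Monoidal.μIso (degZero C) Y (iA.obj a)).symm ≪≫
    (e ⊗ᵢ ((degZeroCompMapDb iA).symm.app a)) ≪≫ μₗIso (mapDb iA) Z ((degZero A).obj a)⟩⟩

/-- The inclusion of an abelian subcategory whose derived category is a triangulated tensor ideal
is a module functor. -/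
@[reducible]
noncomputable def inclusionLeftLinear [MonoidalLeftAction C A]
    (h : LeftLinearAlong (degZero C) (degZero A)) : iA.LeftLinear C :=
  letI := restrictAction (degZero C) (Bounded A)
  letI := restrictAction (degZero C) (Bounded C)
  letI := restrictLeftLinear (degZero C) (mapDb iA)
  letI := leftLinearAlongSelf (degZero C)
  liftLeftLinear (degZero A) (degZero C) (mapDb iA) iA (degZeroCompMapDb iA).symm

end

lemma isZero_bounded_of_isZero (h : ∀ a : A, IsZero a) (X : Bounded A) : IsZero X :=
  not_not.1 fun hX => (exists_coh_of_not_isZero hX).elim fun _ hn => hn (h _)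

end Ideals

/-! ### Preservation of hearts by the monoidal functor and by the equivalence. -/

section Transfer

open MonoidalLeftAction

/-- A monoidal triangulated functor which restricts to triangulated tensor ideals with finitely
many simple objects maps the heart to the heart. -/
lemma mem_essImage_degZero_map (k : Type t) [Field k]
    {C : Type u₁} [Category.{v₁} C] [Abelian C] [Linear k C] [MonoidalCategory C]
    [MonoidalPreadditive C] [MonoidalLinear k C] [RigidCategory C] [IsTensorCategory k C]
    [HasDerivedCategory.{w₁} C]
    {D : Type u₂} [Category.{v₂} D] [Abelian D] [Linear k D] [MonoidalCategory D]
    [MonoidalPreadditive D] [MonoidalLinear k D] [RigidCategory D] [IsTensorCategory k D]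
    [HasDerivedCategory.{w₂} D] {A : Type u₃} [Category.{v₃} A] [Abelian A]
    (iA : A ⥤ C) [iA.Additive] [PreservesFiniteLimits iA]
    [PreservesFiniteColimits iA] [iA.Faithful] (hA : FinitelyManySimples A)
    [MonoidalLeftAction C A] [iA.LeftLinear C]
    (F : Bounded C ⥤ Bounded D) [F.Monoidal] [F.CommShift ℤ] [F.IsTriangulated]
    (h0 : ∃ a, ¬ IsZero (F.obj ((degZero C).obj (iA.obj a)))) (X : C) :
    (degZero D).essImage (F.obj ((degZero C).obj X)) := by
  have (a : A) : IsArtinianObject a :=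
    have := (IsTensorCategory.finite_length k (iA.obj a)).2
    isArtinianObject_of_map iA a
  have (a : A) : IsNoetherianObject a :=
    have := (IsTensorCategory.finite_length k (iA.obj a)).1
    isNoetherianObject_of_map iA a
  -- The family consists of the images of all objects of `A`; tensoring with the image of `X` moves
  -- the member at `a` to the one at `X ⊙ₗ a`.
  refine mem_essImage_degZero_of_family (not_isZero_tensor k) _
    (fun a => F.obj ((degZero C).obj (iA.obj a))) (fun a => X ⊙ₗ a) (fun a => ⟨?_⟩) ?_ h0
  · exact Functor.Monoidal.μIso F _ _ ≪≫ F.mapIso (Functor.Monoidal.μIso (degZero C) _ _ ≪≫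
      (degZero C).mapIso (Functor.LeftLinear.μₗIso iA X a))
  · refine exists_uniform_amplitude hA (tB D) tB_bounded (iA ⋙ degZero C ⋙ F) (fun S hS => ?_)
    obtain ⟨δ, hδ⟩ := degZero_distinguished (hS.map_of_exact iA)
    exact ⟨_, F.map_distinguished _ hδ⟩

/-- A triangulated equivalence of bounded derived categories which preserves the hearts induces an
equivalence of the hearts. -/
lemma exists_equivalence_of_heart {A : Type u₁} [Category.{v₁} A] [Abelian A]
    [HasDerivedCategory.{w₁} A] {B : Type u₂} [Category.{v₂} B] [Abelian B]
    [HasDerivedCategory.{w₂} B] (G : Bounded A ⥤ Bounded B) [G.CommShift ℤ] [G.IsTriangulated]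
    [G.IsEquivalence] (hG : ∀ a, (degZero B).essImage (G.obj ((degZero A).obj a))) :
    ∃ e : A ≌ B, Nonempty (e.functor ⋙ degZero B ≅ degZero A ⋙ G) := by
  let G₀ := Functor.essImage.liftFunctor (degZero A ⋙ G) (degZero B) hG
  let φ : G₀ ⋙ degZero B ≅ degZero A ⋙ G :=
    Functor.essImage.liftFunctorCompIso (degZero A ⋙ G) (degZero B) hG
  have : G₀.Full := Functor.Full.of_comp_faithful_iso φ
  have : G₀.Faithful := Functor.Faithful.of_comp_iso φ
  -- Preserving the heart is not enough here: a preimage under `G` of an object of the heart must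
  -- itself lie in the heart, which is the reflection statement `amplitude_of_map`.
  have : G₀.EssSurj := ⟨fun b => by
    let X := G.objPreimage ((degZero B).obj b)
    let e : G.obj X ≅ (degZero B).obj b := G.objObjPreimageIso _
    obtain ⟨h1, h2⟩ := amplitude_of_map (tB A) (tB B) G (fun X h h' => by
      obtain ⟨a, ⟨e⟩⟩ := mem_essImage_degZero X h h'
      exact (mem_essImage_degZero_iff _).1 ((hG a).ofIso (G.mapIso e))) tB_bounded X 0 0
      ((tB B).isGE_of_iso e.symm 0) ((tB B).isLE_of_iso e.symm 0)
    obtain ⟨a, ⟨e'⟩⟩ := mem_essImage_degZero X h1 h2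
    exact ⟨a, ⟨(degZero B).preimageIso (φ.app a ≪≫ G.mapIso e' ≪≫ e)⟩⟩⟩
  have : G₀.IsEquivalence := {}
  exact ⟨G₀.asEquivalence, ⟨φ⟩⟩

end Transfer

end BoundedTensor

/-! ### The equivalence of module categories. -/

theorem theorem4p5
    {k : Type t} [Field k] [IsAlgClosed k]
    -- the tensor categories
    {C : Type u₁} [Category.{v₁} C] [Abelian C] [Linear k C] [MonoidalCategory C]
    [MonoidalPreadditive C] [MonoidalLinear k C] [RigidCategory C] [IsTensorCategory k C]
    [HasDerivedCategory.{w₁} C]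
    {D : Type u₂} [Category.{v₂} D] [Abelian D] [Linear k D] [MonoidalCategory D]
    [MonoidalPreadditive D] [MonoidalLinear k D] [RigidCategory D] [IsTensorCategory k D]
    [HasDerivedCategory.{w₂} D]
    -- the abelian subcategories, with their exact (not necessarily full) inclusions
    {A : Type u₃} [Category.{v₃} A] [Abelian A] [Linear k A] [HasDerivedCategory.{w₃} A]
    {B : Type u₄} [Category.{v₄} B] [Abelian B] [Linear k B] [HasDerivedCategory.{w₄} B]
    (iA : A ⥤ C) [iA.Additive] [iA.Linear k] [PreservesFiniteLimits iA]
    [PreservesFiniteColimits iA] [iA.Faithful]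
    (iB : B ⥤ D) [iB.Additive] [iB.Linear k] [PreservesFiniteLimits iB]
    [PreservesFiniteColimits iB] [iB.Faithful]
    (hA : FinitelyManySimples A) (hB : FinitelyManySimples B)
    -- the derived categories of the subcategories are left triangulated tensor ideals
    [(mapDb iA).Faithful] [MonoidalLeftAction (Bounded C) (Bounded A)]
    [(mapDb iA).LeftLinear (Bounded C)]
    [(mapDb iB).Faithful] [MonoidalLeftAction (Bounded D) (Bounded B)]
    [(mapDb iB).LeftLinear (Bounded D)]
    -- the monoidal triangulated functor and its restriction
    (F : Bounded C ⥤ Bounded D) [F.Monoidal] [F.CommShift ℤ] [F.IsTriangulated]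
    (G : Bounded A ⥤ Bounded B) [G.CommShift ℤ] [G.IsTriangulated]
    (restr : G ⋙ mapDb iB ≅ mapDb iA ⋙ F) [LeftLinearAlong F G]
    [G.IsEquivalence] :
    ∃ (_ : MonoidalLeftAction C A) (_ : MonoidalLeftAction C B) (e : A ≌ B),
      -- the two actions are those induced by the action on the derived categories
      Nonempty (LeftLinearAlong (degZero C) (degZero A)) ∧
      Nonempty (LeftLinearAlong (degZero C ⋙ F) (degZero B)) ∧
      -- they define module categories
      IsBiexactAction C A ∧ IsBiexactAction C B ∧ IsBilinearAction k C A ∧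
      (F.Linear k → IsBilinearAction k C B ∧ e.functor.Linear k) ∧
      -- and the equivalence is an equivalence of module categories
      Nonempty (e.functor.LeftLinear C) := by
  -- On `A`, the functor `F` agrees with `G` followed by the inclusion of the second ideal, both
  -- faithful. So `F` does not kill a nonzero object of `A`.
  have hΦ : (iA ⋙ degZero C ⋙ F).Faithful := Functor.Faithful.of_iso
    (Functor.isoWhiskerLeft (degZero A) restr ≪≫
      Functor.isoWhiskerRight (degZeroCompMapDb iA) F : degZero A ⋙ G ⋙ mapDb iB ≅ _)
  -- the action on `A`
  obtain ⟨_, ⟨jA⟩⟩ : ∃ (_ : MonoidalLeftAction C A),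
      Nonempty (LeftLinearAlong (degZero C) (degZero A)) :=
    letI := restrictAction (degZero C) (Bounded A)
    exists_action (degZero A)
      (fun X a => mem_essImage_degZero_act iA _ ((degZero C).obj_mem_essImage X) a)
  let _ := inclusionLeftLinear iA jA
  -- The amplitude argument needs a nonzero member of the family, so the case `A = 0` is kept apart.
  have hF : (∀ a : A, IsZero a) ∨ ∀ X : C, (degZero D).essImage (F.obj ((degZero C).obj X)) := by
    rw [or_iff_not_imp_left, not_forall]
    rintro ⟨a, ha⟩ X
    refine mem_essImage_degZero_map k iA hA F ⟨a, fun h => ha ?_⟩ X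
    rw [IsZero.iff_id_eq_zero] at h ⊢
    exact (iA ⋙ degZero C ⋙ F).map_injective (by
      rw [CategoryTheory.Functor.map_id, Functor.map_zero]
      exact h)
  -- In the degenerate case the equivalence `G` makes the second ideal zero as well, and every
  -- condition on hearts is trivial.
  have hzero (h : ∀ a : A, IsZero a) (Z : Bounded B) : IsZero Z :=
    (G.map_isZero (isZero_bounded_of_isZero h _)).of_iso (G.objObjPreimageIso Z).symm
  -- the action on `B`
  obtain ⟨_, ⟨jB⟩⟩ : ∃ (_ : MonoidalLeftAction C B),
      Nonempty (LeftLinearAlong (degZero C ⋙ F) (degZero B)) :=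
    letI := restrictAction (degZero C ⋙ F) (Bounded B)
    exists_action (degZero B) (fun X b => hF.elim
      (fun h => mem_essImage_degZero_of_isZero (hzero h _))
      (fun h => mem_essImage_degZero_act iB _ (h X) b))
  -- the equivalence
  obtain ⟨e, ⟨φ⟩⟩ := exists_equivalence_of_heart G (fun a => hF.elim
    (fun h => mem_essImage_degZero_of_isZero (hzero h _)) (fun h => by
      rw [mem_essImage_degZero_iff, ← isGE_mapDb_iff iB, ← isLE_mapDb_iff iB,
        ← mem_essImage_degZero_iff]
      exact (h (iA.obj a)).ofIso ((F.mapIso ((degZeroCompMapDb iA).app a)).symm ≪≫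
        (restr.app ((degZero A).obj a)).symm)))
  obtain ⟨eL⟩ : Nonempty (e.functor.LeftLinear C) := by
    let _ := restrictAction (degZero C) (Bounded A)
    -- Restricting the structure of `G` to `C` yields the action on `Bounded B` restricted in two
    -- stages, first along `F` and then along `degZero C`; this equals the restriction along the
    -- composite.
    have h : @Functor.LeftLinear _ _ _ _ G C _ _ _ (restrictAction (degZero C ⋙ F) (Bounded B)) := by
      rw [← restrictAction_comp]
      letI := restrictAction F (Bounded B)
      exact restrictLeftLinear (degZero C) G
    let _ := restrictAction (degZero C ⋙ F) (Bounded B)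
    exact ⟨liftLeftLinear (degZero A) (degZero B) G e.functor φ⟩
  have hadd : e.functor.Additive :=
    have := Functor.additive_of_iso φ.symm
    Functor.additive_of_comp_faithful _ (degZero B)
  have hbiex : IsBiexactAction C A := .of_faithful iA isBiexactAction_self
  have hbilin : IsBilinearAction k C A := .of_faithful iA (isBilinearAction_self k)
  refine ⟨inferInstance, inferInstance, e, ⟨jA⟩, ⟨jB⟩, hbiex, .of_equivalence e hbiex, hbilin,
    fun hF => ?_, ⟨eL⟩⟩
  -- `G` is not assumed `k`-linear. Linearity is tested in `Bounded D`, where the equivalence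
  -- becomes the inclusion of `A` followed by `F`.
  have hlin : e.functor.Linear k := by
    have h1 : e.functor ⋙ iB ⋙ degZero D ≅ iA ⋙ degZero C ⋙ F :=
      Functor.isoWhiskerLeft e.functor (degZeroCompMapDb iB).symm ≪≫
        Functor.isoWhiskerRight φ (mapDb iB) ≪≫ Functor.isoWhiskerLeft (degZero A) restr ≪≫
        Functor.isoWhiskerRight (degZeroCompMapDb iA) F
    have := Functor.linear_of_iso k h1.symm
    exact linear_of_comp_faithful e.functor (iB ⋙ degZero D)
  exact ⟨.of_equivalence e hbilin, hlin⟩
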